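/- Let $\mathcal H$ be a complex Hilbert space with scalar product $\langle\cdot,\cdot\rangle$ antilinear in the first argument, and let $H$ and $A$ be (possibly unbounded) self-adjoint operators in $\mathcal H$ with domains $\mathcal D(H)$ and $\mathcal D(A)$. Suppose that $(H-i)^{-1}\in C^1(A)$, that is, for every $\varphi\in\mathcal H$ the map $\mathbb R\ni t\mapsto e^{-itA}(H-i)^{-1}e^{itA}\varphi\in\mathcal H$ is of class $C^1$. In this case the form $(u,v)\mapsto\langle Hu,Av\rangle-\langle Au,Hv\rangle$ on $\mathcal D(H)\cap\mathcal D(A)$ extends uniquely to a sesquilinear form on $\mathcal D(H)$ that is continuous for the graph topology; denote by $[H,A]$ this form, identified with a continuous operator from $\mathcal D(H)$ to its adjoint space $\mathcal D(H)^*$, and set $[iH,A]=i[H,A]$. Let $(H+i)^{-1}[iH,A](H-i)^{-1}$ be the bounded operator $B$ on $\mathcal H$ determined by $\langle\varphi,B\psi\rangle=i\,[H,A]\big((H-i)^{-1}\varphi,(H-i)^{-1}\psi\big)$ for all $\varphi,\psi\in\mathcal H$. Assume that $$(H+i)^{-1}[iH,A](H-i)^{-1}=g(H)$$ for some function $g\in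 C^2(\mathbb R;\mathbb R)\cap L^\infty(\mathbb R)$, where $g(H)$ is defined by functional calculus. Let $\Lambda:=\mathbb R\setminus g^{-1}(\{0\})$ and let $\chi_\Lambda(H)$ be the spectral projection of $H$ on $\Lambda$. Then the restriction $H|_{\chi_\Lambda(H)\mathcal H}$, a self-adjoint operator in the Hilbert space $\chi_\Lambda(H)\mathcal H$, has purely absolutely continuous spectrum: the spectral measure of each of its vectors is absolutely continuous with respect to Lebesgue measure. -/

import Mathlib

open MeasureTheory

noncomputable section

/-- A projection-valued measure (resolution of the identity) on the Borel sets of `ℝ`, acting in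
the Hilbert space `E`. Non-measurable sets are sent to `0` by convention. -/
structure PVM (E : Type*) [NormedAddCommGroup E] [InnerProductSpace ℂ E] [CompleteSpace E] where
  proj : Set ℝ → E →L[ℂ] E
  isStarProjection : ∀ s, MeasurableSet s → IsStarProjection (proj s)
  not_measurable : ∀ s, ¬ MeasurableSet s → proj s = 0
  proj_univ : proj Set.univ = 1
  proj_inter : ∀ s t, MeasurableSet s → MeasurableSet t → proj (s ∩ t) = proj s * proj t
  hasSum_proj : ∀ s : ℕ → Set ℝ, (∀ n, MeasurableSet (s n)) →
    Pairwise (fun m n => Disjoint (s m) (s n)) →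
    ∀ φ : E, HasSum (fun n => proj (s n) φ) (proj (⋃ n, s n) φ)

namespace PVM

variable {E : Type*} [NormedAddCommGroup E] [InnerProductSpace ℂ E] [CompleteSpace E]

theorem isStarProjection_proj (P : PVM E) (s : Set ℝ) : IsStarProjection (P.proj s) := by
  by_cases hs : MeasurableSet s
  · exact P.isStarProjection s hs
  · rw [P.not_measurable s hs]
    exact IsStarProjection.zero _

theorem proj_empty (P : PVM E) : P.proj ∅ = 0 := by
  ext φ
  have h := P.hasSum_proj (fun _ => ∅) (fun _ => MeasurableSet.empty)
    (fun _ _ _ => disjoint_bot_left) φ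
  exact tendsto_nhds_unique tendsto_const_nhds h.summable.tendsto_atTop_zero

theorem re_inner_proj (P : PVM E) (s : Set ℝ) (φ : E) :
    (inner ℂ φ (P.proj s φ)).re = ‖P.proj s φ‖ ^ 2 := by
  have h := P.isStarProjection_proj s
  have h1 : P.proj s (P.proj s φ) = P.proj s φ := congrArg (fun T : E →L[ℂ] E => T φ) h.1
  have h2 : inner ℂ φ (P.proj s (P.proj s φ)) = inner ℂ (P.proj s φ) (P.proj s φ) := by
    rw [← ContinuousLinearMap.adjoint_inner_left, ← ContinuousLinearMap.star_eq_adjoint,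
      h.2.star_eq]
  rw [← h1, h2, h1, inner_self_eq_norm_sq_to_K]
  norm_cast

/-- The scalar spectral measure `s ↦ ⟨φ, P(s) φ⟩ = ‖P(s) φ‖²` of the vector `φ`. -/
def measure (P : PVM E) (φ : E) : Measure ℝ :=
  Measure.ofMeasurable (fun s _ => ENNReal.ofReal (‖P.proj s φ‖ ^ 2))
    (by simp [P.proj_empty])
    (by
      intro s hs hd
      have h := ((P.hasSum_proj s hs hd φ).mapL (innerSL ℂ φ)).mapL Complex.reCLM
      have h' : HasSum (fun n => ‖P.proj (s n) φ‖ ^ 2) (‖P.proj (⋃ n, s n) φ‖ ^ 2) := by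
        simpa [re_inner_proj] using h
      rw [← h'.tsum_eq, ENNReal.ofReal_tsum_of_nonneg (fun n => by positivity) h'.summable])

theorem measure_apply (P : PVM E) (φ : E) {s : Set ℝ} (hs : MeasurableSet s) :
    P.measure φ s = ENNReal.ofReal (‖P.proj s φ‖ ^ 2) :=
  Measure.ofMeasurable_apply s hs

open scoped Classical in
/-- The bounded operator `∫ f dP` for a bounded Borel function `f`: the (unique, by polarization)
bounded operator `B` with `⟨φ, B φ⟩ = ∫ f(x) d⟨φ, P(x) φ⟩` for all `φ`. -/
def integral (P : PVM E) (f : ℝ → ℂ) : E →L[ℂ] E :=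
  if h : ∃ B : E →L[ℂ] E, ∀ φ, inner ℂ φ (B φ) = ∫ x, f x ∂(P.measure φ) then h.choose else 0

/-- The closed subspace `P(s) E`. -/
def range (P : PVM E) (s : Set ℝ) : Submodule ℂ E := LinearMap.range (P.proj s).toLinearMap

instance (P : PVM E) (s : Set ℝ) : CompleteSpace (P.range s) := by
  have h : IsClosed ((P.range s : Submodule ℂ E) : Set E) :=
    ContinuousLinearMap.IsIdempotentElem.isClosed_range (P.isStarProjection_proj s).1
  exact h.completeSpace_coe

open scoped Classical in
/-- The Dirac projection-valued measure at `0`, used only as a default value. -/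
instance : Inhabited (PVM E) where
  default :=
    { proj := fun s => if MeasurableSet s ∧ (0 : ℝ) ∈ s then 1 else 0
      isStarProjection := by
        intro s _
        split_ifs
        · exact IsStarProjection.one _
        · exact IsStarProjection.zero _
      not_measurable := by
        intro s hs
        simp [hs]
      proj_univ := by simp
      proj_inter := by
        intro s t hs ht
        by_cases h1 : (0 : ℝ) ∈ s <;> by_cases h2 : (0 : ℝ) ∈ t <;> simp [hs, ht, hs.inter ht, h1, h2]
      hasSum_proj := by
        intro s hs hd φ
        by_cases h : ∃ n, (0 : ℝ) ∈ s n
        · obtain ⟨n, hn⟩ := h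
          have h0 : (0 : ℝ) ∈ ⋃ n, s n := Set.mem_iUnion.2 ⟨n, hn⟩
          have h1 := hasSum_single (f := fun m =>
            (if MeasurableSet (s m) ∧ (0 : ℝ) ∈ s m then (1 : E →L[ℂ] E) else 0) φ) n (by
              intro m hm
              have : (0 : ℝ) ∉ s m := fun h' => Set.disjoint_left.1 (hd hm) h' hn
              simp [this])
          simpa [hs n, hn, h0, MeasurableSet.iUnion hs] using h1
        · have h0 : (0 : ℝ) ∉ ⋃ n, s n := fun h' => h (Set.mem_iUnion.1 h')
          have h1 : ∀ n, (0 : ℝ) ∉ s n := fun n hn => h ⟨n, hn⟩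
          simp [h0, h1, hasSum_zero] }

end PVM

namespace LinearPMap

variable {E : Type*} [NormedAddCommGroup E] [InnerProductSpace ℂ E] [CompleteSpace E]

/-- `P` is the spectral measure of `T`, that is `T = ∫ x dP(x)`:
`dom T = {φ | ∫ x² d⟨φ, P(x) φ⟩ < ∞}` and `⟨φ, T φ⟩ = ∫ x d⟨φ, P(x) φ⟩` for `φ ∈ dom T`. -/
structure IsSpectralMeasure (T : E →ₗ.[ℂ] E) (P : PVM E) : Prop where
  mem_domain_iff : ∀ φ : E, φ ∈ T.domain ↔ Integrable (fun x : ℝ => x ^ 2) (P.measure φ)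
  inner_apply : ∀ φ : T.domain,
    inner ℂ (φ : E) (T φ) = ((∫ x, x ∂(P.measure (φ : E)) : ℝ) : ℂ)

open scoped Classical in
/-- The spectral measure of a self-adjoint operator `T` (which exists and is unique by the spectral
theorem), written `s ↦ χ_s(T)`. If `T` has no spectral measure this is a default value. -/
def spectralMeasure (T : E →ₗ.[ℂ] E) : PVM E :=
  if h : ∃ P, IsSpectralMeasure T P then h.choose else default

/-- The functional calculus `f ↦ f(T)`, for bounded Borel functions `f`. -/
def fc (T : E →ₗ.[ℂ] E) (f : ℝ → ℂ) : E →L[ℂ] E := T.spectralMeasure.integral f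

/-- The unitary group `t ↦ e^{itT}`. -/
def unitaryGroup (T : E →ₗ.[ℂ] E) (t : ℝ) : E →L[ℂ] E :=
  T.fc fun x => Complex.exp (Complex.I * t * x)

/-- `S ∈ C^k(A)`: the map `t ↦ e^{-itA} S e^{itA}` is strongly of class `C^k`. -/
def IsClassC (k : ℕ) (A : E →ₗ.[ℂ] E) (S : E →L[ℂ] E) : Prop :=
  ∀ φ : E, ContDiff ℝ k fun t : ℝ => A.unitaryGroup (-t) (S (A.unitaryGroup t φ))

/-- The bounded operator `T - z : dom T → E`. Here `dom T`, with its graph topology, is realized as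
the graph of `T`, a subspace of `E × E`. -/
def subScalar (T : E →ₗ.[ℂ] E) (z : ℂ) : T.graph →L[ℂ] E :=
  (ContinuousLinearMap.snd ℂ E E - z • ContinuousLinearMap.fst ℂ E E).comp T.graph.subtypeL

/-- The inverse `(T - z)⁻¹ : E → dom T` (with junk value `0` if `T - z` has no bounded inverse). -/
def resolventToDom (T : E →ₗ.[ℂ] E) (z : ℂ) : E →L[ℂ] T.graph := (T.subScalar z).inverse

/-- The resolvent `(T - z)⁻¹` as a bounded operator in `E`. -/
def resolventAt (T : E →ₗ.[ℂ] E) (z : ℂ) : E →L[ℂ] E :=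
  (ContinuousLinearMap.fst ℂ E E).comp (T.graph.subtypeL.comp (T.resolventToDom z))

/-- The continuous sesquilinear form `F` on `dom H` (with its graph topology; antilinear in the
first variable) extends the commutator form
`(u, v) ↦ ⟨H u, A v⟩ - ⟨A u, H v⟩` defined on `dom H ∩ dom A`. -/
def ExtendsCommutator (H A : E →ₗ.[ℂ] E) (F : H.graph →L⋆[ℂ] H.graph →L[ℂ] ℂ) : Prop :=
  ∀ (u v : H.domain) (hu : (u : E) ∈ A.domain) (hv : (v : E) ∈ A.domain),
    F ⟨((u : E), H u), H.mem_graph u⟩ ⟨((v : E), H v), H.mem_graph v⟩ =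
      inner ℂ (H u) (A ⟨v, hv⟩) - inner ℂ (A ⟨u, hu⟩) (H v)

open scoped Classical in
/-- The commutator `[H, A]`, as a continuous sesquilinear form on `dom H` (equivalently, a
continuous operator from `dom H` to its adjoint space). If `H` is of class `C¹(A)`, then
`dom H ∩ dom A` is a core for `H` and this is the unique continuous extension of the commutator
form; if there is no continuous extension the value is `0`. -/
def commutator (H A : E →ₗ.[ℂ] E) : H.graph →L⋆[ℂ] H.graph →L[ℂ] ℂ :=
  if h : ∃ F, ExtendsCommutator H A F then h.choose else 0

/-- The bounded operator `(H + i)⁻¹ [iH, A] (H - i)⁻¹` in `E`, where `(H + i)⁻¹` is understood as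
the map from the adjoint space of `dom H` to `E` that is adjoint to `(H - i)⁻¹ : E → dom H`.
Writing `R = (H - i)⁻¹`, it is the operator `B` with `⟨φ, B ψ⟩ = i [H, A](R φ, R ψ)`. -/
def sandwichedCommutator (H A : E →ₗ.[ℂ] E) : E →L[ℂ] E :=
  ContinuousLinearMap.adjoint (InnerProductSpace.continuousLinearMapOfBilin
    ((Complex.I • H.commutator A).bilinearComp
      (H.resolventToDom Complex.I) (H.resolventToDom Complex.I)))

theorem inner_sandwichedCommutator (H A : E →ₗ.[ℂ] E) (φ ψ : E) :
    inner ℂ φ (H.sandwichedCommutator A ψ) = Complex.I *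
      H.commutator A (H.resolventToDom Complex.I φ) (H.resolventToDom Complex.I ψ) := by
  rw [sandwichedCommutator, ContinuousLinearMap.adjoint_inner_right,
    InnerProductSpace.continuousLinearMapOfBilin_apply]
  rfl

/-- The part of `T` in the subspace `K`: its graph is the set of `(u, w) ∈ K × K` with
`u ∈ dom T` and `T u = w`. If `K` reduces `T`, its domain is `dom T ∩ K` and it is the restriction
`T|_K`. -/
def restrictTo (T : E →ₗ.[ℂ] E) (K : Submodule ℂ E) : K →ₗ.[ℂ] K :=
  (T.graph.comap (K.subtype.prodMap K.subtype)).toLinearPMap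

/-- `T` is self-adjoint with purely absolutely continuous spectrum: the spectral measure of every
vector is absolutely continuous with respect to Lebesgue measure. -/
def HasPurelyACSpectrum (T : E →ₗ.[ℂ] E) : Prop :=
  IsSelfAdjoint T ∧ ∀ φ : E, (T.spectralMeasure.measure φ).AbsolutelyContinuous volume

end LinearPMap

end

/-! Write `V = (H + i)(H - i)⁻¹` for the Cayley transform and `B = g(H)` for the sandwiched
commutator. Formally `[A, V] = 2V B`, so `V` preserves the domain of `A` and `A V = V (A + 2B)`
there (`cayley_mem_graph`). Since `g(H)` commutes with `V`, iteration gives `[A, Vⁿ] = 2n Vⁿ g(H)`,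
first for natural `n` and then, through adjoints, for every integer (`commForm_zpow`).

With `c(x) = (x + i)/(x - i)`, one has `(cⁿ)' = -2in (1 + x²)⁻¹ cⁿ`. Hence, for `k = cⁿ` and `K(t) =
∫_{-∞}^t (k - mean k) dx/(1 + x²)`, the formula says that, in the sense of forms on the domain of
`A`, `[A, K(H)] = i (k - mean k)(H) g(H)`. The mean is taken for the normalized Cauchy measure; it
takes care of `n = 0`. Both sides are linear in `k` and continuous under bounded pointwise limits.
The map `c` identifies the line with a circle minus a point, and trigonometric polynomials are dense
in the continuous functions there, so the formula extends to all bounded Borel `k`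
(`commForm_cauchyPrimitive`).

Now let `s` be Lebesgue null and `k = 1_s sign(g)`. Then `K = 0` and `mean k = 0`, so the left side
vanishes and the right side becomes `∫_s |g| dμ_φ = 0` for every `φ` in the domain of `A`. Thus the
spectral projection of `s ∩ {g ≠ 0}` kills a dense set and is zero (`proj_inter_eq_zero`), which is
the absolute continuity sought.

The rest is foundation. The spectral theorem is derived from the continuous functional calculus of
the normal operator `(H - i)⁻¹`; it is also shown that any spectral measure integrates `(x - i)⁻¹`
to the resolvent, so the chosen one can be used. The commutator form is shown to have a continuous
extension, so that its chosen value is not the default `0`. -/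

noncomputable section

set_option linter.unusedSectionVars false

/-! ### Resolvents of self-adjoint operators and a range criterion for self-adjointness. -/

namespace LinearPMap

variable {E : Type*} [NormedAddCommGroup E] [InnerProductSpace ℂ E] [CompleteSpace E]

theorem symmetric_of_isSelfAdjoint {T : E →ₗ.[ℂ] E} (hT : IsSelfAdjoint T) (u v : T.domain) :
    inner ℂ (T u) (v : E) = inner ℂ (u : E) (T v) := by
  have h := adjoint_isFormalAdjoint hT.dense_domain
  rw [isSelfAdjoint_def.mp hT] at h
  exact h u v

theorem mem_graph_of_forall_inner {T : E →ₗ.[ℂ] E} (hT : IsSelfAdjoint T) {y w : E}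
    (h : ∀ x : T.domain, inner ℂ w (x : E) = inner ℂ y (T x)) : (y, w) ∈ T.graph := by
  have h1 : (y, w) ∈ T.adjoint.graph := by
    rw [mem_graph_iff]
    exact ⟨⟨y, mem_adjoint_domain_of_exists y ⟨w, h⟩⟩, rfl, adjoint_apply_eq hT.dense_domain _ h⟩
  rwa [isSelfAdjoint_def.mp hT] at h1

theorem inner_graph_of_isSelfAdjoint {T : E →ₗ.[ℂ] E} (hT : IsSelfAdjoint T) {p q : E × E}
    (hp : p ∈ T.graph) (hq : q ∈ T.graph) : inner ℂ p.2 q.1 = inner ℂ p.1 q.2 := by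
  obtain ⟨u, hu, hu'⟩ := (mem_graph_iff _).1 hp
  obtain ⟨v, hv, hv'⟩ := (mem_graph_iff _).1 hq
  rw [← hu, ← hu', ← hv, ← hv']
  exact symmetric_of_isSelfAdjoint hT u v

/-- `⟨u, T u⟩` is real, so the imaginary part of `⟨u, (T - z) u⟩` is `-Im z ‖u‖²`; Cauchy–Schwarz
does the rest. -/
theorem abs_im_mul_norm_le {T : E →ₗ.[ℂ] E} (hT : IsSelfAdjoint T) (z : ℂ) {p : E × E}
    (hp : p ∈ T.graph) : |z.im| * ‖p.1‖ ≤ ‖p.2 - z • p.1‖ := by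
  have h1 : (inner ℂ p.1 p.2).im = 0 := by
    have := inner_graph_of_isSelfAdjoint hT hp hp
    rw [← inner_conj_symm] at this
    exact Complex.conj_eq_iff_im.1 this
  have h2 : (inner ℂ p.1 (p.2 - z • p.1)).im = -z.im * ‖p.1‖ ^ 2 := by
    have h : inner ℂ p.1 p.1 = ((‖p.1‖ ^ 2 : ℝ) : ℂ) := by
      rw [inner_self_eq_norm_sq_to_K]
      norm_cast
    rw [inner_sub_right, inner_smul_right, h, Complex.sub_im, h1, Complex.im_mul_ofReal]
    ring
  have h3 : |z.im| * ‖p.1‖ ^ 2 ≤ ‖p.1‖ * ‖p.2 - z • p.1‖ := by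
    calc |z.im| * ‖p.1‖ ^ 2 = |(inner ℂ p.1 (p.2 - z • p.1)).im| := by
          rw [h2, abs_mul, abs_neg, abs_of_nonneg (sq_nonneg ‖p.1‖)]
      _ ≤ ‖inner ℂ p.1 (p.2 - z • p.1)‖ := Complex.abs_im_le_norm _
      _ ≤ _ := norm_inner_le_norm _ _
  rcases (norm_nonneg p.1).eq_or_lt with h | h
  · rw [← h]; simp
  · nlinarith

theorem subScalar_apply (T : E →ₗ.[ℂ] E) (z : ℂ) (p : T.graph) :
    T.subScalar z p = (p : E × E).2 - z • (p : E × E).1 := rfl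

theorem ker_subScalar {T : E →ₗ.[ℂ] E} (hT : IsSelfAdjoint T) {z : ℂ} (hz : z.im ≠ 0) :
    LinearMap.ker (T.subScalar z : T.graph →ₗ[ℂ] E) = ⊥ := by
  rw [LinearMap.ker_eq_bot']
  intro p hp
  have hp : (p : E × E).2 - z • (p : E × E).1 = 0 := hp
  have h := abs_im_mul_norm_le hT z p.2
  rw [hp, norm_zero] at h
  have h1 : (p : E × E).1 = 0 := by
    have := abs_pos.2 hz
    rw [← norm_eq_zero]
    nlinarith [norm_nonneg (p : E × E).1]
  rw [h1] at hp
  ext1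
  exact Prod.ext h1 (by simpa using hp)

theorem completeSpace_graph {T : E →ₗ.[ℂ] E} (hT : IsSelfAdjoint T) : CompleteSpace T.graph :=
  IsClosed.completeSpace_coe (hs := hT.isClosed)

theorem antilipschitz_subScalar {T : E →ₗ.[ℂ] E} (hT : IsSelfAdjoint T) {z : ℂ} (hz : z.im ≠ 0) :
    ∃ K, AntilipschitzWith K (T.subScalar z) := by
  have hz' := abs_pos.2 hz
  -- With `w = (T - z) u`, `‖u‖ ≤ ‖w‖ / |Im z|` and `‖T u‖ ≤ ‖w‖ + ‖z‖ ‖u‖`. The constant is the sum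
  -- of the two bounds, which dominates the maximum defining the norm of the graph.
  refine ⟨Real.toNNReal (1 + (1 + ‖z‖) / |z.im|),
    AddMonoidHomClass.antilipschitz_of_bound _ fun p => ?_⟩
  rw [Real.coe_toNNReal _ (by positivity), subScalar_apply]
  have h := abs_im_mul_norm_le hT z p.2
  set w := (p : E × E).2 - z • (p : E × E).1 with hw
  have h1 : ‖(p : E × E).1‖ ≤ ‖w‖ / |z.im| := by
    rw [le_div_iff₀ hz']; linarith
  have h2 : ‖(p : E × E).2‖ ≤ ‖w‖ + ‖z‖ * ‖(p : E × E).1‖ := by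
    have : (p : E × E).2 = w + z • (p : E × E).1 := by rw [hw]; abel
    rw [this, ← norm_smul]
    exact norm_add_le _ _
  have h3 : (1 + (1 + ‖z‖) / |z.im|) * ‖w‖ = ‖w‖ + ‖w‖ / |z.im| + ‖z‖ * (‖w‖ / |z.im|) := by
    field_simp
    ring
  have h4 : ‖z‖ * ‖(p : E × E).1‖ ≤ ‖z‖ * (‖w‖ / |z.im|) := by gcongr
  rw [h3]
  refine max_le (show ‖(p : E × E).1‖ ≤ _ from ?_) (show ‖(p : E × E).2‖ ≤ _ from ?_)
  · have : 0 ≤ ‖z‖ * (‖w‖ / |z.im|) := by positivity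
    have := norm_nonneg w
    linarith
  · have : 0 ≤ ‖w‖ / |z.im| := by positivity
    linarith

/-- The range is closed because `T - z` is bounded below on a complete graph. A vector orthogonal to
it would be an eigenvector of `T* = T` for the non-real value `conj z`, hence is zero. -/
theorem range_subScalar {T : E →ₗ.[ℂ] E} (hT : IsSelfAdjoint T) {z : ℂ} (hz : z.im ≠ 0) :
    LinearMap.range (T.subScalar z : T.graph →ₗ[ℂ] E) = ⊤ := by
  have := completeSpace_graph hT
  obtain ⟨K, hK⟩ := antilipschitz_subScalar hT hz
  have hcl : _root_.IsClosed (LinearMap.range (T.subScalar z : T.graph →ₗ[ℂ] E) : Set E) := by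
    have := hK.isClosed_range (T.subScalar z).uniformContinuous
    rwa [LinearMap.coe_range]
  have := hcl.completeSpace_coe
  rw [← Submodule.orthogonal_eq_bot_iff, Submodule.eq_bot_iff]
  intro w hw
  have h1 : ∀ x : T.domain, inner ℂ (starRingEnd ℂ z • w) (x : E) = inner ℂ w (T x) := by
    intro x
    have := Submodule.inner_left_of_mem_orthogonal
      (LinearMap.mem_range_self (T.subScalar z : T.graph →ₗ[ℂ] E) ⟨_, T.mem_graph x⟩) hw
    have this : inner ℂ w (T x - z • (x : E)) = 0 := this
    rw [inner_sub_right, inner_smul_right, sub_eq_zero] at this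
    rw [inner_smul_left, this, Complex.conj_conj]
  have h2 := abs_im_mul_norm_le hT (starRingEnd ℂ z) (mem_graph_of_forall_inner hT h1)
  simp only [sub_self, norm_zero, Complex.conj_im, abs_neg] at h2
  have := abs_pos.2 hz
  rw [← norm_eq_zero]
  nlinarith [norm_nonneg w]

theorem resolventToDom_subScalar {T : E →ₗ.[ℂ] E} (hT : IsSelfAdjoint T) {z : ℂ} (hz : z.im ≠ 0) :
    (∀ p : T.graph, T.resolventToDom z (T.subScalar z p) = p) ∧
      ∀ φ : E, T.subScalar z (T.resolventToDom z φ) = φ := by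
  have := completeSpace_graph hT
  let e := ContinuousLinearEquiv.ofBijective (T.subScalar z) (ker_subScalar hT hz)
    (range_subScalar hT hz)
  have he : (e : T.graph →L[ℂ] E) = T.subScalar z := ContinuousLinearEquiv.coe_ofBijective _ _ _
  have h : T.resolventToDom z = e.symm := by
    rw [resolventToDom, ← he, ContinuousLinearMap.inverse_equiv]
  rw [h, ← he]
  exact ⟨fun p => e.symm_apply_apply p, fun φ => e.apply_symm_apply φ⟩

theorem resolventToDom_fst (T : E →ₗ.[ℂ] E) (z : ℂ) (φ : E) :
    (T.resolventToDom z φ : E × E).1 = T.resolventAt z φ := rfl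

theorem resolventToDom_snd {T : E →ₗ.[ℂ] E} (hT : IsSelfAdjoint T) {z : ℂ} (hz : z.im ≠ 0)
    (φ : E) : (T.resolventToDom z φ : E × E).2 = φ + z • T.resolventAt z φ := by
  have := (resolventToDom_subScalar hT hz).2 φ
  rw [subScalar_apply, sub_eq_iff_eq_add] at this
  exact this

theorem resolventAt_mem_graph {T : E →ₗ.[ℂ] E} (hT : IsSelfAdjoint T) {z : ℂ} (hz : z.im ≠ 0)
    (φ : E) : (T.resolventAt z φ, φ + z • T.resolventAt z φ) ∈ T.graph := by
  rw [← resolventToDom_snd hT hz φ]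
  exact (T.resolventToDom z φ).2

theorem resolventAt_sub {T : E →ₗ.[ℂ] E} (hT : IsSelfAdjoint T) {z : ℂ} (hz : z.im ≠ 0)
    {u w : E} (h : (u, w) ∈ T.graph) : T.resolventAt z (w - z • u) = u := by
  have := (resolventToDom_subScalar hT hz).1 ⟨_, h⟩
  rw [← resolventToDom_fst]
  exact congrArg (fun p : T.graph => (p : E × E).1) this

theorem mem_graph_iff_resolventAt {T : E →ₗ.[ℂ] E} (hT : IsSelfAdjoint T) {z : ℂ} (hz : z.im ≠ 0)
    {u w : E} : (u, w) ∈ T.graph ↔ T.resolventAt z (w - z • u) = u := by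
  refine ⟨resolventAt_sub hT hz, fun h => ?_⟩
  have := resolventAt_mem_graph hT hz (w - z • u)
  rw [h] at this
  simpa using this

/-- `⟪R φ, ψ⟫ - ⟪φ, R ψ⟫ = -2i ⟪R φ, R ψ⟫` for `R = (T - i)⁻¹`. -/
theorem inner_resolventAt_I {T : E →ₗ.[ℂ] E} (hT : IsSelfAdjoint T) (φ ψ : E) :
    inner ℂ (T.resolventAt Complex.I φ) ψ = inner ℂ φ (T.resolventAt Complex.I ψ) -
      2 * Complex.I * inner ℂ (T.resolventAt Complex.I φ) (T.resolventAt Complex.I ψ) := by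
  have hI : Complex.I.im ≠ 0 := by simp
  have := inner_graph_of_isSelfAdjoint hT (resolventAt_mem_graph hT hI φ)
    (resolventAt_mem_graph hT hI ψ)
  simp only [inner_add_left, inner_add_right, inner_smul_left, inner_smul_right,
    Complex.conj_I] at this
  linear_combination -this

/-- Density of the domain is not assumed: it follows from surjectivity of `T ± i`. This is what
makes the criterion convenient for the part of an operator in a subspace. -/
theorem isSelfAdjoint_of_forall_exists {T : E →ₗ.[ℂ] E}
    (hsymm : ∀ u v : T.domain, inner ℂ (T u) (v : E) = inner ℂ (u : E) (T v))
    (h1 : ∀ η : E, ∃ u : T.domain, T u - Complex.I • (u : E) = η)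
    (h2 : ∀ η : E, ∃ u : T.domain, T u + Complex.I • (u : E) = η) : IsSelfAdjoint T := by
  have hdense : Dense (T.domain : Set E) := by
    rw [Submodule.dense_iff_topologicalClosure_eq_top, Submodule.topologicalClosure_eq_top_iff,
      Submodule.eq_bot_iff]
    intro η hη
    -- A vector `η = (T + i) u` orthogonal to the domain satisfies, with `u = (T - i) v`, `0 = ⟨η,
    -- v⟩ = ⟨u, (T - i) v⟩ = ‖u‖²`.
    obtain ⟨u, rfl⟩ := h2 η
    obtain ⟨v, hv⟩ := h1 (u : E)
    have h := Submodule.inner_left_of_mem_orthogonal v.2 hη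
    rw [inner_add_left, inner_smul_left, hsymm, Complex.conj_I, neg_mul, ← sub_eq_add_neg,
      ← inner_smul_right, ← inner_sub_right, hv, inner_self_eq_zero] at h
    have : u = 0 := Subtype.ext h
    simp [this]
  rw [isSelfAdjoint_def]
  refine le_antisymm ?_ (IsFormalAdjoint.le_adjoint hdense hsymm)
  have hle : T.adjoint.domain ≤ T.domain := by
    intro y hy
    -- Solve `(T - i) u = (T* - i) y` inside the domain; then `y - u` is orthogonal to the range of
    -- `T + i`, which is everything.
    obtain ⟨u, hu⟩ := h1 (T.adjoint ⟨y, hy⟩ - Complex.I • y)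
    have hyu : y - u = 0 := by
      rw [← @inner_self_eq_zero ℂ]
      obtain ⟨v, hv⟩ := h2 (y - u)
      have e1 : inner ℂ (T.adjoint ⟨y, hy⟩) (v : E) = inner ℂ y (T v) :=
        adjoint_isFormalAdjoint hdense ⟨y, hy⟩ v
      have e2 := hsymm u v
      have e3 : T.adjoint ⟨y, hy⟩ = T u - Complex.I • (u : E) + Complex.I • y := by
        rw [hu]; abel
      rw [e3] at e1
      nth_rewrite 2 [← hv]
      simp only [inner_add_left, inner_sub_left, inner_smul_left, inner_add_right,
        inner_smul_right, Complex.conj_I] at e1 e2 ⊢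
      linear_combination e2 - e1
    rw [sub_eq_zero] at hyu
    rw [hyu]
    exact u.2
  refine ⟨hle, fun x y hxy => adjoint_apply_eq hdense x fun v => ?_⟩
  rw [hxy]
  exact hsymm y v

end LinearPMap
end

/-! ### Bounded measurable functions and their induction principles. -/

noncomputable section

set_option linter.unusedSectionVars false

open Filter Topology

/-- Bounded measurable complex functions. -/
structure BddMeas {X : Type*} [MeasurableSpace X] (f : X → ℂ) : Prop where
  measurable : Measurable f
  bounded : ∃ C : ℝ, ∀ x, ‖f x‖ ≤ C

namespace BddMeas

variable {X : Type*} [MeasurableSpace X] {f g : X → ℂ}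

theorem const (c : ℂ) : BddMeas fun _ : X => c := ⟨measurable_const, ‖c‖, fun _ => le_rfl⟩

theorem add (hf : BddMeas f) (hg : BddMeas g) : BddMeas fun x => f x + g x := by
  obtain ⟨C, hC⟩ := hf.bounded
  obtain ⟨D, hD⟩ := hg.bounded
  exact ⟨hf.measurable.add hg.measurable, C + D, fun x =>
    (norm_add_le _ _).trans (add_le_add (hC x) (hD x))⟩

theorem mul (hf : BddMeas f) (hg : BddMeas g) : BddMeas fun x => f x * g x := by
  obtain ⟨C, hC⟩ := hf.bounded
  obtain ⟨D, hD⟩ := hg.bounded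
  exact ⟨hf.measurable.mul hg.measurable, C * D, fun x => by
    rw [norm_mul]
    exact mul_le_mul (hC x) (hD x) (norm_nonneg _) ((norm_nonneg _).trans (hC x))⟩

theorem const_mul (c : ℂ) (hf : BddMeas f) : BddMeas fun x => c * f x := (const c).mul hf

theorem conj (hf : BddMeas f) : BddMeas fun x => starRingEnd ℂ (f x) := by
  obtain ⟨C, hC⟩ := hf.bounded
  exact ⟨Complex.continuous_conj.measurable.comp hf.measurable, C, fun x => by simpa using hC x⟩

theorem sub (hf : BddMeas f) (hg : BddMeas g) : BddMeas fun x => f x - g x := by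
  simpa [sub_eq_add_neg] using hf.add (hg.const_mul (-1))

theorem pow (hf : BddMeas f) (n : ℕ) : BddMeas fun x => f x ^ n := by
  induction n with
  | zero => simpa using const 1
  | succ n ih => simpa [pow_succ] using ih.mul hf

theorem indicator (hf : BddMeas f) {s : Set X} (hs : MeasurableSet s) :
    BddMeas (s.indicator f) := by
  obtain ⟨C, hC⟩ := hf.bounded
  exact ⟨hf.measurable.indicator hs, C, fun x => (norm_indicator_le_norm_self _ _).trans (hC x)⟩

theorem comp {Y : Type*} [MeasurableSpace Y] (hf : BddMeas f) {m : Y → X} (hm : Measurable m) :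
    BddMeas fun y => f (m y) :=
  ⟨hf.measurable.comp hm, hf.bounded.imp fun _ hC y => hC (m y)⟩

theorem integrable (hf : BddMeas f) (μ : Measure X) [IsFiniteMeasure μ] : Integrable f μ := by
  obtain ⟨C, hC⟩ := hf.bounded
  exact Integrable.of_bound hf.measurable.aestronglyMeasurable C (ae_of_all _ hC)

theorem of_tendsto {F : ℕ → X → ℂ} (hF : ∀ n, BddMeas (F n)) {C : ℝ} (hC : ∀ n x, ‖F n x‖ ≤ C)
    (h : ∀ x, Tendsto (fun n => F n x) atTop (𝓝 (f x))) : BddMeas f :=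
  ⟨measurable_of_tendsto_metrizable (fun n => (hF n).measurable) (tendsto_pi_nhds.2 h), C,
    fun x => le_of_tendsto (h x).norm (Eventually.of_forall fun n => hC n x)⟩

/-- Induction principle for bounded measurable functions, starting from indicator functions. -/
theorem induction {p : (X → ℂ) → Prop}
    (ind : ∀ (c : ℂ) (s : Set X), MeasurableSet s → p (s.indicator fun _ => c))
    (add : ∀ f g, BddMeas f → BddMeas g → p f → p g → p fun x => f x + g x)
    (lim : ∀ (F : ℕ → X → ℂ) (f : X → ℂ) (C : ℝ), (∀ n, BddMeas (F n)) → (∀ n x, ‖F n x‖ ≤ C) →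
      (∀ x, Tendsto (fun n => F n x) atTop (𝓝 (f x))) → (∀ n, p (F n)) → p f)
    {f : X → ℂ} (hf : BddMeas f) : p f := by
  have hs : ∀ u : SimpleFunc X ℂ, BddMeas u := fun u =>
    ⟨u.measurable, u.exists_forall_norm_le⟩
  have simple : ∀ u : SimpleFunc X ℂ, p u := by
    intro u
    induction u using SimpleFunc.induction with
    | @const c s hs =>
      rw [SimpleFunc.coe_piecewise, SimpleFunc.coe_const, SimpleFunc.coe_const]
      convert ind c _ hs using 1
      ext x
      by_cases hx : x ∈ s <;> simp [hx]
    | add _ h1 h2 => exact add _ _ (hs _) (hs _) h1 h2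
  obtain ⟨C, hC⟩ := hf.bounded
  have hf' := hf.measurable.stronglyMeasurable
  rcases isEmpty_or_nonempty X with hX | ⟨⟨x⟩⟩
  · rw [Subsingleton.elim f (0 : SimpleFunc X ℂ)]
    exact simple _
  · have hC0 : 0 ≤ C := (norm_nonneg _).trans (hC x)
    exact lim (fun n => hf'.approxBounded C n) f C (fun n => hs _)
      (fun n x => hf'.norm_approxBounded_le hC0 n x)
      (fun x => hf'.tendsto_approxBounded_of_norm_le (hC x)) fun n => simple _

/-- Induction principle for bounded measurable functions, starting from continuous functions. -/
theorem induction_continuous {X : Type*} [PseudoEMetricSpace X] [MeasurableSpace X] [BorelSpace X]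
    {p : (X → ℂ) → Prop}
    (cont : ∀ f : X → ℂ, Continuous f → BddMeas f → p f)
    (add : ∀ f g, BddMeas f → BddMeas g → p f → p g → p fun x => f x + g x)
    (smul : ∀ (c : ℂ) f, BddMeas f → p f → p fun x => c * f x)
    (lim : ∀ (F : ℕ → X → ℂ) (f : X → ℂ) (C : ℝ), (∀ n, BddMeas (F n)) → (∀ n x, ‖F n x‖ ≤ C) →
      (∀ x, Tendsto (fun n => F n x) atTop (𝓝 (f x))) → (∀ n, p (F n)) → p f)
    {f : X → ℂ} (hf : BddMeas f) : p f := by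
  have key : ∀ s : Set X, MeasurableSet s → p (s.indicator fun _ => 1) := by
    -- Dynkin's π-λ argument from the closed sets, whose indicators are bounded limits of the
    -- continuous thickened indicators.
    refine MeasurableSpace.induction_on_inter (C := fun s _ => p (s.indicator fun _ => 1))
      (BorelSpace.measurable_eq.trans borel_eq_generateFrom_isClosed) isPiSystem_isClosed
      ?_ ?_ ?_ ?_
    · simpa using cont _ continuous_const (const 0)
    · intro s hs
      have hpos : ∀ n : ℕ, (0 : ℝ) < 1 / (n + 1) := fun n => Nat.one_div_pos_of_nat
      have hle : ∀ n x, ‖((thickenedIndicator (hpos n) s x : ℝ) : ℂ)‖ ≤ 1 := by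
        intro n x
        rw [Complex.norm_real, Real.norm_of_nonneg NNReal.zero_le_coe]
        exact_mod_cast thickenedIndicator_le_one (hpos n) s x
      have hcont : ∀ n, Continuous fun x => ((thickenedIndicator (hpos n) s x : ℝ) : ℂ) := fun n =>
        Complex.continuous_ofReal.comp
          (NNReal.continuous_coe.comp (thickenedIndicator (hpos n) s).continuous)
      have hb : ∀ n, BddMeas fun x => ((thickenedIndicator (hpos n) s x : ℝ) : ℂ) := fun n =>
        ⟨(hcont n).measurable, 1, hle n⟩
      refine lim _ _ 1 hb hle (fun x => ?_) fun n => cont _ (hcont n) (hb n)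
      have := tendsto_pi_nhds.1 (thickenedIndicator_tendsto_indicator_closure hpos
        tendsto_one_div_add_atTop_nhds_zero_nat s) x
      rw [IsClosed.closure_eq hs] at this
      have h2 := ((Complex.continuous_ofReal.comp NNReal.continuous_coe).tendsto _).comp this
      have e : s.indicator (fun _ => (1 : ℂ)) x = (Complex.ofReal ∘ NNReal.toReal)
          (s.indicator (fun _ => 1) x) := by
        by_cases hx : x ∈ s <;> simp [hx]
      rw [e]
      exact h2
    · intro s hs h
      have := add _ _ (const 1) (((const 1).indicator hs).const_mul (-1))
        (cont _ continuous_const (const 1)) (smul (-1) _ ((const 1).indicator hs) h)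
      convert this using 2 with x
      by_cases hx : x ∈ s <;> simp [hx]
    · intro s hd hs h
      have hb : ∀ n, BddMeas ((⋃ i ∈ Finset.range n, s i).indicator fun _ => (1 : ℂ)) := fun n =>
        (const 1).indicator (Finset.measurableSet_biUnion _ fun i _ => hs i)
      refine lim (fun n => (⋃ i ∈ Finset.range n, s i).indicator fun _ => 1) _ 1 hb ?_ ?_ ?_
      · intro n x
        exact (norm_indicator_le_norm_self _ _).trans (by simp)
      · intro x
        by_cases hx : x ∈ ⋃ i, s i
        · obtain ⟨i, hi⟩ := Set.mem_iUnion.1 hx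
          refine tendsto_const_nhds.congr' ?_
          filter_upwards [eventually_gt_atTop i] with n hn
          rw [Set.indicator_of_mem hx, Set.indicator_of_mem]
          exact Set.mem_biUnion (Finset.mem_coe.2 (Finset.mem_range.2 hn)) hi
        · refine tendsto_const_nhds.congr fun n => ?_
          rw [Set.indicator_of_notMem hx, Set.indicator_of_notMem]
          exact fun h' => hx (Set.iUnion₂_subset_iUnion _ _ h')
      · intro n
        induction n with
        | zero => simpa using cont _ continuous_const (const 0)
        | succ n ih =>
          have := add _ _ (hb n) ((const 1).indicator (hs n)) ih (h n)
          convert this using 1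
          rw [Finset.range_add_one, Finset.set_biUnion_insert, Set.union_comm]
          refine Set.indicator_union_of_disjoint ?_ _
          rw [Set.disjoint_iUnion₂_left]
          exact fun i hi => hd (Finset.mem_range.1 hi).ne
  refine hf.induction (fun c s hs => ?_) add lim
  have := smul c _ ((const 1).indicator hs) (key s hs)
  convert this using 2 with x
  by_cases hx : x ∈ s <;> simp [hx]

end BddMeas

/-! ### Operators determined by their quadratic form through a family of measures. -/

section Represents

variable {E : Type*} [NormedAddCommGroup E] [InnerProductSpace ℂ E] [CompleteSpace E]

theorem inner_apply_polarization (T : E →L[ℂ] E) (x y : E) :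
    inner ℂ x (T y) =
      (inner ℂ (x + y) (T (x + y)) - inner ℂ (x - y) (T (x - y)) -
        Complex.I * inner ℂ (x + Complex.I • y) (T (x + Complex.I • y)) +
        Complex.I * inner ℂ (x - Complex.I • y) (T (x - Complex.I • y))) / 4 := by
  simp only [map_add, map_sub, inner_add_left, inner_add_right, map_smul, inner_smul_left,
    inner_smul_right, Complex.conj_I, inner_sub_left, inner_sub_right]
  ring_nf
  simp only [Complex.I_sq]
  ring

/-- Polarization and two parallelogram laws give `|⟨x, T y⟩| ≤ C (‖x‖² + ‖y‖²)`; testing with the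
multiple of `T x` that has the norm of `x` gives the factor 2. -/
theorem norm_apply_le_of_inner_self_le (T : E →L[ℂ] E) {C : ℝ}
    (h : ∀ φ, ‖inner ℂ φ (T φ)‖ ≤ C * ‖φ‖ ^ 2) (x : E) : ‖T x‖ ≤ 2 * C * ‖x‖ := by
  have key : ∀ x y, ‖inner ℂ x (T y)‖ ≤ C * (‖x‖ ^ 2 + ‖y‖ ^ 2) := by
    intro x y
    have e1 := parallelogram_law_with_norm ℂ x y
    have e2 := parallelogram_law_with_norm ℂ x (Complex.I • y)
    rw [norm_smul, Complex.norm_I, one_mul] at e2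
    rw [inner_apply_polarization, norm_div]
    have h4 : ‖(4 : ℂ)‖ = 4 := by simp
    rw [h4, div_le_iff₀ (by norm_num)]
    refine (norm_add_le _ _).trans ((add_le_add_left ((norm_sub_le _ _).trans
      (add_le_add_left (norm_sub_le _ _) _)) _).trans ?_)
    simp only [norm_mul, Complex.norm_I, one_mul]
    have h1 := h (x + y)
    have h2 := h (x - y)
    have h3 := h (x + Complex.I • y)
    have h5 := h (x - Complex.I • y)
    have : C * ‖x + y‖ ^ 2 + C * ‖x - y‖ ^ 2 + C * ‖x + Complex.I • y‖ ^ 2 +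
        C * ‖x - Complex.I • y‖ ^ 2 = C * (‖x‖ ^ 2 + ‖y‖ ^ 2) * 4 := by
      linear_combination C * e1 + C * e2
    linarith
  rcases eq_or_ne (T x) 0 with h0 | h0
  · have := key x x
    rcases eq_or_ne x 0 with hx | hx
    · simp [hx]
    · have hx' := norm_pos_iff.2 hx
      rw [h0, inner_zero_right, norm_zero] at this
      have : 0 ≤ C := by
        by_contra hC
        push Not at hC
        nlinarith [mul_pos hx' hx']
      rw [h0, norm_zero]
      positivity
  · have h0' := norm_pos_iff.2 h0
    have := key (((‖x‖ / ‖T x‖ : ℝ) : ℂ) • T x) x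
    rw [inner_smul_left, norm_mul, norm_smul, inner_self_eq_norm_sq_to_K] at this
    simp only [Complex.conj_ofReal, Complex.norm_real, norm_div, norm_norm, norm_pow,
      Complex.coe_algebraMap] at this
    rw [div_mul_cancel₀ _ h0'.ne'] at this
    have e : ‖x‖ / ‖T x‖ * ‖T x‖ ^ 2 = ‖x‖ * ‖T x‖ := by field_simp
    rw [e] at this
    rcases (norm_nonneg x).eq_or_lt with hx | hx
    · have : x = 0 := norm_eq_zero.1 hx.symm
      simp [this] at h0
    · nlinarith

/-- A weakly convergent bounded sequence of operators has a limit. -/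
theorem exists_weak_limit {B : ℕ → E →L[ℂ] E} {C : ℝ}
    (hC : ∀ n φ, ‖inner ℂ φ (B n φ)‖ ≤ C * ‖φ‖ ^ 2) {q : E → ℂ}
    (hq : ∀ φ, Tendsto (fun n => inner ℂ φ (B n φ)) atTop (𝓝 (q φ))) :
    ∃ L : E →L[ℂ] E, ∀ φ, inner ℂ φ (L φ) = q φ := by
  have h1 : ∀ φ ψ, ∃ l, Tendsto (fun n => inner ℂ φ (B n ψ)) atTop (𝓝 l) := by
    intro φ ψ
    simp_rw [inner_apply_polarization _ φ ψ]
    exact ⟨_, (((((hq _).sub (hq _)).sub ((hq _).const_mul _)).add ((hq _).const_mul _)).div_const _)⟩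
  choose b hb using h1
  have hbound : ∀ φ ψ, ‖b φ ψ‖ ≤ 2 * C * ‖φ‖ * ‖ψ‖ := by
    intro φ ψ
    refine le_of_tendsto (hb φ ψ).norm (Eventually.of_forall fun n => ?_)
    refine (norm_inner_le_norm _ _).trans ?_
    have := norm_apply_le_of_inner_self_le (B n) (hC n) ψ
    calc ‖φ‖ * ‖B n ψ‖ ≤ ‖φ‖ * (2 * C * ‖ψ‖) := by gcongr
      _ = _ := by ring
  let β : E →ₗ⋆[ℂ] E →ₗ[ℂ] ℂ := LinearMap.mk₂'ₛₗ (starRingEnd ℂ) (RingHom.id ℂ) b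
    (fun x y z => tendsto_nhds_unique (hb _ _) (by
      simpa only [inner_add_left] using (hb x z).add (hb y z)))
    (fun c x y => tendsto_nhds_unique (hb _ _) (by
      simpa only [inner_smul_left, smul_eq_mul] using (hb x y).const_mul (starRingEnd ℂ c)))
    (fun x y z => tendsto_nhds_unique (hb _ _) (by
      simpa only [map_add, inner_add_right] using (hb x y).add (hb x z)))
    (fun c x y => tendsto_nhds_unique (hb _ _) (by
      simpa only [map_smul, inner_smul_right, smul_eq_mul, RingHom.id_apply] using
        (hb x y).const_mul c))
  refine ⟨ContinuousLinearMap.adjoint (InnerProductSpace.continuousLinearMapOfBilin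
    (β.mkContinuous₂ (2 * C) hbound)), fun φ => ?_⟩
  rw [ContinuousLinearMap.adjoint_inner_right,
    InnerProductSpace.continuousLinearMapOfBilin_apply]
  exact tendsto_nhds_unique (hb φ φ) (hq φ)

variable {X : Type*} [MeasurableSpace X]

/-- The operator `B` is given by `⟪φ, B φ⟫ = ∫ f dμ_φ`, where `μ` is a family of measures indexed
by the vectors. -/
def Represents (μ : E → Measure X) (f : X → ℂ) (B : E →L[ℂ] E) : Prop :=
  ∀ φ, inner ℂ φ (B φ) = ∫ x, f x ∂(μ φ)

namespace Represents

variable {μ : E → Measure X} {f g : X → ℂ} {B D : E →L[ℂ] E}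

theorem clm_ext (h : ∀ φ, inner ℂ φ (B φ) = inner ℂ φ (D φ)) : B = D := by
  ext y
  refine ext_inner_left ℂ fun x => ?_
  rw [inner_apply_polarization, inner_apply_polarization D]
  simp only [h]

theorem unique (hB : Represents μ f B) (hD : Represents μ f D) : B = D :=
  clm_ext fun φ => (hB φ).trans (hD φ).symm

theorem smul (c : ℂ) (hB : Represents μ f B) : Represents μ (fun x => c * f x) (c • B) := by
  intro φ
  rw [smul_apply, inner_smul_right, hB φ, integral_const_mul]

variable [hμ : ∀ φ, IsFiniteMeasure (μ φ)]

theorem add (hf : BddMeas f) (hg : BddMeas g) (hB : Represents μ f B) (hD : Represents μ g D) :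
    Represents μ (fun x => f x + g x) (B + D) := by
  intro φ
  rw [add_apply, inner_add_right, hB φ, hD φ,
    integral_add (hf.integrable _) (hg.integrable _)]

theorem adjoint (hB : Represents μ f B) :
    Represents μ (fun x => starRingEnd ℂ (f x)) (ContinuousLinearMap.adjoint B) := by
  intro φ
  rw [ContinuousLinearMap.adjoint_inner_right, ← inner_conj_symm, hB φ, integral_conj]

theorem tendsto {F : ℕ → X → ℂ} {Bn : ℕ → E →L[ℂ] E} {C : ℝ} (hF : ∀ n, BddMeas (F n))
    (hC : ∀ n x, ‖F n x‖ ≤ C) (hlim : ∀ x, Tendsto (fun n => F n x) atTop (𝓝 (f x)))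
    (hBn : ∀ n, Represents μ (F n) (Bn n)) (hB : Represents μ f B) (φ ψ : E) :
    Tendsto (fun n => inner ℂ φ (Bn n ψ)) atTop (𝓝 (inner ℂ φ (B ψ))) := by
  have hq : ∀ φ, Tendsto (fun n => inner ℂ φ (Bn n φ)) atTop (𝓝 (inner ℂ φ (B φ))) := by
    intro φ
    rw [hB φ]
    simp_rw [fun n => hBn n φ]
    exact tendsto_integral_of_dominated_convergence (fun _ => C)
      (fun n => (hF n).measurable.aestronglyMeasurable) (integrable_const C)
      (fun n => ae_of_all _ (hC n)) (ae_of_all _ hlim)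
  simp_rw [inner_apply_polarization _ φ ψ]
  exact (((((hq _).sub (hq _)).sub ((hq _).const_mul _)).add ((hq _).const_mul _)).div_const _)

/-- The mass bound makes the quadratic forms uniformly bounded, so their pointwise limit, given by
dominated convergence, is again that of a bounded operator. -/
theorem exists_of_tendsto (hμ' : ∀ φ, (μ φ).real Set.univ ≤ ‖φ‖ ^ 2)
    {F : ℕ → X → ℂ} {Bn : ℕ → E →L[ℂ] E} {C : ℝ} (hF : ∀ n, BddMeas (F n))
    (hC : ∀ n x, ‖F n x‖ ≤ C) (hlim : ∀ x, Tendsto (fun n => F n x) atTop (𝓝 (f x)))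
    (hBn : ∀ n, Represents μ (F n) (Bn n)) : ∃ B, Represents μ f B := by
  refine exists_weak_limit (B := Bn) (C := |C|) (fun n φ => ?_) fun φ => ?_
  · rw [hBn n φ]
    refine (norm_integral_le_of_norm_le_const (C := |C|)
      (ae_of_all _ fun x => (hC n x).trans (le_abs_self C))).trans ?_
    have := hμ' φ
    gcongr
  · simp_rw [fun n => hBn n φ]
    exact tendsto_integral_of_dominated_convergence (fun _ => C)
      (fun n => (hF n).measurable.aestronglyMeasurable) (integrable_const C)
      (fun n => ae_of_all _ (hC n)) (ae_of_all _ hlim)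

/-- If `f` and all the `F n g` are represented by `B` and `Bn n D`, then so is the limit. -/
theorem mul_of_tendsto (hg : BddMeas g) {F : ℕ → X → ℂ} {Bn : ℕ → E →L[ℂ] E} {C : ℝ}
    (hF : ∀ n, BddMeas (F n))
    (hC : ∀ n x, ‖F n x‖ ≤ C) (hlim : ∀ x, Tendsto (fun n => F n x) atTop (𝓝 (f x)))
    (hBn : ∀ n, Represents μ (F n) (Bn n)) (hB : Represents μ f B)
    (h : ∀ n, Represents μ (fun x => F n x * g x) (Bn n * D)) :
    Represents μ (fun x => f x * g x) (B * D) := by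
  intro φ
  obtain ⟨G, hG⟩ := hg.bounded
  refine tendsto_nhds_unique (tendsto hF hC hlim hBn hB φ (D φ)) ?_
  have e : ∀ n, inner ℂ φ (Bn n (D φ)) = ∫ x, F n x * g x ∂(μ φ) := fun n => h n φ
  simp_rw [e]
  exact tendsto_integral_of_dominated_convergence (fun _ => C * G)
    (fun n => ((hF n).mul hg).measurable.aestronglyMeasurable) (integrable_const _)
    (fun n => ae_of_all _ fun x => by
      rw [norm_mul]
      exact mul_le_mul (hC n x) (hG x) (norm_nonneg _) ((norm_nonneg _).trans (hC n x)))
    (ae_of_all _ fun x => (hlim x).mul_const _)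

end Represents

end Represents

end

/-! ### Functional calculus of a projection-valued measure. -/

noncomputable section

set_option linter.unusedSectionVars false

open Filter Topology

namespace PVM

variable {E : Type*} [NormedAddCommGroup E] [InnerProductSpace ℂ E] [CompleteSpace E] (P : PVM E)

instance isFiniteMeasure_measure (φ : E) : IsFiniteMeasure (P.measure φ) :=
  ⟨by rw [P.measure_apply φ MeasurableSet.univ]; exact ENNReal.ofReal_lt_top⟩

theorem measureReal_apply (φ : E) {s : Set ℝ} (hs : MeasurableSet s) :
    (P.measure φ).real s = ‖P.proj s φ‖ ^ 2 := by
  rw [measureReal_def, P.measure_apply φ hs, ENNReal.toReal_ofReal (by positivity)]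

theorem measureReal_univ (φ : E) : (P.measure φ).real Set.univ = ‖φ‖ ^ 2 := by
  rw [P.measureReal_apply φ MeasurableSet.univ, P.proj_univ, one_apply_eq_self]

theorem measure_eq_zero_iff (φ : E) {s : Set ℝ} (hs : MeasurableSet s) :
    P.measure φ s = 0 ↔ P.proj s φ = 0 := by
  rw [P.measure_apply φ hs, ENNReal.ofReal_eq_zero]
  constructor
  · intro h
    exact norm_eq_zero.1 (pow_eq_zero_iff two_ne_zero |>.1 (le_antisymm h (by positivity)))
  · intro h
    simp [h]

theorem inner_proj (s : Set ℝ) (φ : E) :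
    inner ℂ φ (P.proj s φ) = ((‖P.proj s φ‖ ^ 2 : ℝ) : ℂ) := by
  have h := P.isStarProjection_proj s
  have h1 : P.proj s (P.proj s φ) = P.proj s φ := congrArg (fun T : E →L[ℂ] E => T φ) h.1
  have h2 : inner ℂ φ (P.proj s (P.proj s φ)) = inner ℂ (P.proj s φ) (P.proj s φ) := by
    rw [← ContinuousLinearMap.adjoint_inner_left, ← ContinuousLinearMap.star_eq_adjoint,
      h.2.star_eq]
  rw [← h1, h2, h1, inner_self_eq_norm_sq_to_K]
  norm_cast

theorem represents_proj {s : Set ℝ} (hs : MeasurableSet s) :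
    Represents P.measure (s.indicator fun _ => 1) (P.proj s) := by
  intro φ
  rw [P.inner_proj, integral_indicator_const _ hs, P.measureReal_apply φ hs]
  simp

/-- For bounded Borel functions the choice in `PVM.integral` never falls back on its default value
`0`. -/
theorem represents_integral {f : ℝ → ℂ} (hf : BddMeas f) :
    Represents P.measure f (P.integral f) := by
  have h : ∃ B, Represents P.measure f B := by
    refine hf.induction (p := fun f => ∃ B, Represents P.measure f B) ?_ ?_ ?_
    · intro c s hs
      refine ⟨c • P.proj s, ?_⟩
      have h := (P.represents_proj hs).smul c
      have e : (fun x => c * s.indicator (fun _ => (1 : ℂ)) x) = s.indicator fun _ => c := by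
        ext x
        by_cases hx : x ∈ s <;> simp [hx]
      rwa [e] at h
    · rintro f g hf hg ⟨B, hB⟩ ⟨D, hD⟩
      exact ⟨B + D, Represents.add hf hg hB hD⟩
    · intro F f C hF hC hlim h
      choose B hB using h
      exact Represents.exists_of_tendsto (fun φ => (P.measureReal_univ φ).le) hF hC hlim hB
  have e : P.integral f = h.choose := dif_pos h
  rw [e]
  exact h.choose_spec

theorem inner_integral {f : ℝ → ℂ} (hf : BddMeas f) (φ : E) :
    inner ℂ φ (P.integral f φ) = ∫ x, f x ∂(P.measure φ) := P.represents_integral hf φ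

theorem integral_eq {f : ℝ → ℂ} (hf : BddMeas f) {B : E →L[ℂ] E} (hB : Represents P.measure f B) :
    P.integral f = B := (P.represents_integral hf).unique hB

theorem integral_indicator_one {s : Set ℝ} (hs : MeasurableSet s) :
    P.integral (s.indicator fun _ => 1) = P.proj s :=
  P.integral_eq ((BddMeas.const 1).indicator hs) (P.represents_proj hs)

theorem integral_one : P.integral (fun _ => 1) = 1 := by
  rw [← P.proj_univ, ← P.integral_indicator_one MeasurableSet.univ, Set.indicator_univ]

theorem integral_const_mul (c : ℂ) {f : ℝ → ℂ} (hf : BddMeas f) :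
    P.integral (fun x => c * f x) = c • P.integral f :=
  P.integral_eq (hf.const_mul c) ((P.represents_integral hf).smul c)

theorem integral_const (c : ℂ) : P.integral (fun _ => c) = c • 1 := by
  have := P.integral_const_mul c (BddMeas.const 1)
  simpa [P.integral_one] using this

theorem integral_add {f g : ℝ → ℂ} (hf : BddMeas f) (hg : BddMeas g) :
    P.integral (fun x => f x + g x) = P.integral f + P.integral g :=
  P.integral_eq (hf.add hg) (Represents.add hf hg (P.represents_integral hf)
    (P.represents_integral hg))

theorem integral_sub {f g : ℝ → ℂ} (hf : BddMeas f) (hg : BddMeas g) :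
    P.integral (fun x => f x - g x) = P.integral f - P.integral g := by
  have := P.integral_add hf (hg.const_mul (-1))
  rw [P.integral_const_mul _ hg] at this
  simpa [sub_eq_add_neg] using this

theorem integral_conj {f : ℝ → ℂ} (hf : BddMeas f) :
    P.integral (fun x => starRingEnd ℂ (f x)) = ContinuousLinearMap.adjoint (P.integral f) :=
  P.integral_eq hf.conj (P.represents_integral hf).adjoint

/-- Multiplicativity of the projections is spread one factor at a time: `key` extends the first
factor from indicators to all functions, and passing to adjoints exchanges the two factors. -/
theorem integral_mul {f g : ℝ → ℂ} (hf : BddMeas f) (hg : BddMeas g) :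
    P.integral (fun x => f x * g x) = P.integral f * P.integral g := by
  have key : ∀ (g : ℝ → ℂ), BddMeas g → (∀ s, MeasurableSet s →
      P.integral (fun x => s.indicator (fun _ => 1) x * g x) = P.proj s * P.integral g) →
      ∀ {f : ℝ → ℂ}, BddMeas f →
        P.integral (fun x => f x * g x) = P.integral f * P.integral g := by
    intro g hg hs f hf
    refine hf.induction
      (p := fun f => P.integral (fun x => f x * g x) = P.integral f * P.integral g) ?_ ?_ ?_
    · intro c s hs'
      have e1 : (s.indicator fun _ => c) = fun x => c * s.indicator (fun _ => (1 : ℂ)) x := by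
        ext x
        by_cases hx : x ∈ s <;> simp [hx]
      have hb : BddMeas (s.indicator fun _ => (1 : ℂ)) := (BddMeas.const 1).indicator hs'
      have e2 : (fun x => s.indicator (fun _ => c) x * g x) =
          fun x => c * (s.indicator (fun _ => (1 : ℂ)) x * g x) := by
        rw [e1]
        ext x
        ring
      rw [e2, P.integral_const_mul _ (hb.mul hg), hs s hs', e1, P.integral_const_mul _ hb,
        P.integral_indicator_one hs', smul_mul_assoc]
    · intro f f' hf hf' h h'
      simp_rw [add_mul]
      rw [P.integral_add (hf.mul hg) (hf'.mul hg), P.integral_add hf hf', add_mul, h, h']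
    · intro F f C hF hC hlim h
      have hf : BddMeas f := BddMeas.of_tendsto hF hC hlim
      refine P.integral_eq (hf.mul hg) (Represents.mul_of_tendsto hg hF hC hlim
        (fun n => P.represents_integral (hF n)) (P.represents_integral hf) fun n => ?_)
      rw [← h n]
      exact P.represents_integral ((hF n).mul hg)
  refine key g hg (fun s hs => ?_) hf
  have hs1 : BddMeas (s.indicator fun _ => (1 : ℂ)) := (BddMeas.const 1).indicator hs
  -- The case of an indicator times `g` is the adjoint of the case of `conj g` times an indicator,
  -- where `key` only needs products of two projections.
  have h := key _ hs1 (fun t ht => ?_) hg.conj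
  · have h1 := congrArg ContinuousLinearMap.adjoint h
    rw [← P.integral_conj (hg.conj.mul hs1), P.integral_indicator_one hs, P.integral_conj hg,
      ContinuousLinearMap.mul_def, ContinuousLinearMap.adjoint_comp,
      ContinuousLinearMap.adjoint_adjoint, ← ContinuousLinearMap.star_eq_adjoint,
      (P.isStarProjection s hs).2.star_eq, ← ContinuousLinearMap.mul_def] at h1
    rw [← h1]
    congr 1
    ext x
    by_cases hx : x ∈ s <;> simp [hx]
  · rw [P.integral_indicator_one hs, ← P.proj_inter t s ht hs,
      ← P.integral_indicator_one (ht.inter hs)]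
    congr 1
    ext x
    by_cases hx : x ∈ s <;> by_cases hx' : x ∈ t <;> simp [hx, hx']

theorem integral_apply_integral {f g : ℝ → ℂ} (hf : BddMeas f) (hg : BddMeas g) (φ : E) :
    P.integral f (P.integral g φ) = P.integral (fun x => f x * g x) φ := by
  rw [P.integral_mul hf hg]
  rfl

theorem norm_integral_sq {f : ℝ → ℂ} (hf : BddMeas f) (φ : E) :
    ‖P.integral f φ‖ ^ 2 = ∫ x, ‖f x‖ ^ 2 ∂(P.measure φ) := by
  have h : inner ℂ (P.integral f φ) (P.integral f φ) =
      ((∫ x, ‖f x‖ ^ 2 ∂(P.measure φ) : ℝ) : ℂ) := by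
    rw [← ContinuousLinearMap.adjoint_inner_right, ← P.integral_conj hf,
      P.integral_apply_integral hf.conj hf, P.inner_integral (hf.conj.mul hf), ← integral_complex_ofReal]
    congr 1
    ext x
    rw [Complex.conj_mul']
    norm_cast
  rw [inner_self_eq_norm_sq_to_K] at h
  exact Complex.ofReal_injective (by simpa using h)

theorem norm_integral_le {f : ℝ → ℂ} (hf : Measurable f) {C : ℝ} (hC : ∀ x, ‖f x‖ ≤ C) (φ : E) :
    ‖P.integral f φ‖ ≤ C * ‖φ‖ := by
  have h0 : 0 ≤ C := (norm_nonneg _).trans (hC 0)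
  refine le_of_sq_le_sq ?_ (by positivity)
  rw [P.norm_integral_sq ⟨hf, C, hC⟩, mul_pow, ← P.measureReal_univ φ]
  have := integral_mono_of_nonneg (μ := P.measure φ) (f := fun x => ‖f x‖ ^ 2)
    (g := fun _ => C ^ 2) (ae_of_all _ fun x => by positivity) (integrable_const _)
    (ae_of_all _ fun x => pow_le_pow_left₀ (norm_nonneg _) (hC x) 2)
  simpa [mul_comm] using this

/-- Multiplicativity turns `‖P(s) f φ‖²` into `∫_s |f|² dμ_φ`. This lets integrals of unbounded
functions be computed on vectors in the range of the resolvent. -/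
theorem measure_integral {f : ℝ → ℂ} (hf : BddMeas f) (φ : E) :
    P.measure (P.integral f φ) =
      (P.measure φ).withDensity fun x => ENNReal.ofReal (‖f x‖ ^ 2) := by
  ext s hs
  have hs1 : BddMeas (s.indicator fun _ => (1 : ℂ)) := (BddMeas.const 1).indicator hs
  rw [P.measure_apply _ hs, withDensity_apply _ hs, ← P.integral_indicator_one hs,
    P.integral_apply_integral hs1 hf, P.norm_integral_sq (hs1.mul hf)]
  have e : (fun x => ‖s.indicator (fun _ => (1 : ℂ)) x * f x‖ ^ 2) =
      s.indicator fun x => ‖f x‖ ^ 2 := by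
    ext x
    by_cases hx : x ∈ s <;> simp [hx]
  rw [e, integral_indicator hs, ofReal_integral_eq_lintegral_ofReal]
  · have h2 := (hf.conj.mul hf).integrable (P.measure φ)
    have h3 : (fun x => ‖f x‖ ^ 2) = fun x => ((starRingEnd ℂ (f x) * f x)).re := by
      ext x
      rw [Complex.conj_mul']
      norm_cast
    rw [h3]
    exact h2.re.integrableOn
  · exact ae_of_all _ fun x => by positivity

theorem integrable_measure_integral_iff {f : ℝ → ℂ} (hf : BddMeas f) (φ : E) (h : ℝ → ℝ) :
    Integrable h (P.measure (P.integral f φ)) ↔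
      Integrable (fun x => ‖f x‖ ^ 2 * h x) (P.measure φ) := by
  rw [P.measure_integral hf]
  have hm : Measurable fun x => (‖f x‖ ^ 2).toNNReal := (hf.measurable.norm.pow_const 2).real_toNNReal
  have := integrable_withDensity_iff_integrable_smul (μ := P.measure φ) hm (g := h)
  simpa only [ENNReal.ofReal, NNReal.smul_def, smul_eq_mul,
    Real.coe_toNNReal _ (sq_nonneg _)] using this

theorem integral_measure_integral {f : ℝ → ℂ} (hf : BddMeas f) (φ : E) (h : ℝ → ℝ) :
    ∫ x, h x ∂(P.measure (P.integral f φ)) = ∫ x, ‖f x‖ ^ 2 * h x ∂(P.measure φ) := by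
  rw [P.measure_integral hf]
  have hm : Measurable fun x => (‖f x‖ ^ 2).toNNReal := (hf.measurable.norm.pow_const 2).real_toNNReal
  have := integral_withDensity_eq_integral_smul (μ := P.measure φ) hm h
  simpa only [ENNReal.ofReal, NNReal.smul_def, smul_eq_mul,
    Real.coe_toNNReal _ (sq_nonneg _)] using this

theorem tendsto_inner_integral {F : ℕ → ℝ → ℂ} {f : ℝ → ℂ} {C : ℝ} (hF : ∀ n, BddMeas (F n))
    (hC : ∀ n x, ‖F n x‖ ≤ C) (hlim : ∀ x, Tendsto (fun n => F n x) atTop (𝓝 (f x))) (φ ψ : E) :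
    Tendsto (fun n => inner ℂ φ (P.integral (F n) ψ)) atTop (𝓝 (inner ℂ φ (P.integral f ψ))) :=
  Represents.tendsto hF hC hlim (fun n => P.represents_integral (hF n))
    (P.represents_integral (BddMeas.of_tendsto hF hC hlim)) φ ψ

end PVM

end

/-! ### From a continuous calculus on a compact space to a Borel calculus and a projection-valued
measure. -/

noncomputable section

set_option linter.unusedSectionVars false

open Filter Topology

section BorelCalculus

variable {E : Type*} [NormedAddCommGroup E] [InnerProductSpace ℂ E] [CompleteSpace E]
  {X : Type*} [MetricSpace X] [CompactSpace X] [MeasurableSpace X] [BorelSpace X]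

/-- A real continuous function, as a complex one. -/
def ContinuousMap.toComplex (f : C(X, ℝ)) : C(X, ℂ) :=
  ⟨fun x => (f x : ℂ), Complex.continuous_ofReal.comp f.continuous⟩

theorem inner_starAlgHom_sq (Φ : C(X, ℂ) →⋆ₐ[ℂ] (E →L[ℂ] E)) (f : C(X, ℂ)) (φ : E) :
    inner ℂ φ (Φ (star f * f) φ) = ((‖Φ f φ‖ ^ 2 : ℝ) : ℂ) := by
  rw [map_mul, map_star, mul_apply_eq_comp, ContinuousLinearMap.star_eq_adjoint,
    ContinuousLinearMap.adjoint_inner_right, inner_self_eq_norm_sq_to_K]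
  norm_cast

/-- The positive functional `f ↦ ⟪φ, Φ(f) φ⟫`. -/
def positiveFunctional (Φ : C(X, ℂ) →⋆ₐ[ℂ] (E →L[ℂ] E)) (φ : E) :
    CompactlySupportedContinuousMap X ℝ →ₚ[ℝ] ℝ :=
  PositiveLinearMap.mk₀
    { toFun := fun f => (inner ℂ φ (Φ (f : C(X, ℝ)).toComplex φ)).re
      map_add' := fun f g => by
        have : ((f + g : CompactlySupportedContinuousMap X ℝ) : C(X, ℝ)).toComplex =
            (f : C(X, ℝ)).toComplex + (g : C(X, ℝ)).toComplex := by
          ext x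
          simp [ContinuousMap.toComplex]
        rw [this, map_add, add_apply, inner_add_right, Complex.add_re]
      map_smul' := fun c f => by
        have : ((c • f : CompactlySupportedContinuousMap X ℝ) : C(X, ℝ)).toComplex =
            (c : ℂ) • (f : C(X, ℝ)).toComplex := by
          ext x
          simp [ContinuousMap.toComplex]
        rw [this, map_smul, smul_apply, inner_smul_right, Complex.re_ofReal_mul]
        rfl }
    (fun f hf => by
      -- Positivity: a nonnegative `f` is `star r * r` with `r = √f`, so the form equals `‖Φ(r)
      -- φ‖²`.
      let r : C(X, ℂ) := ⟨fun x => (Real.sqrt (f x) : ℂ),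
        Complex.continuous_ofReal.comp (Real.continuous_sqrt.comp f.continuous)⟩
      have : (f : C(X, ℝ)).toComplex = star r * r := by
        ext x
        have hx : 0 ≤ f x := hf x
        change (f x : ℂ) = starRingEnd ℂ (Real.sqrt (f x) : ℂ) * (Real.sqrt (f x) : ℂ)
        rw [Complex.conj_ofReal, ← Complex.ofReal_mul, Real.mul_self_sqrt hx]
      change 0 ≤ (inner ℂ φ (Φ (f : C(X, ℝ)).toComplex φ)).re
      rw [this, inner_starAlgHom_sq, Complex.ofReal_re]
      positivity)

/-- The spectral measure of a vector for the calculus `Φ`. -/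
def calculusMeasure (Φ : C(X, ℂ) →⋆ₐ[ℂ] (E →L[ℂ] E)) (φ : E) : Measure X :=
  RealRMK.rieszMeasure (positiveFunctional Φ φ)

instance (Φ : C(X, ℂ) →⋆ₐ[ℂ] (E →L[ℂ] E)) (φ : E) : IsFiniteMeasure (calculusMeasure Φ φ) := by
  have : (calculusMeasure Φ φ).Regular := by unfold calculusMeasure; infer_instance
  infer_instance

theorem represents_toComplex (Φ : C(X, ℂ) →⋆ₐ[ℂ] (E →L[ℂ] E)) (f : C(X, ℝ)) :
    Represents (calculusMeasure Φ) f.toComplex (Φ f.toComplex) := by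
  intro φ
  have h := RealRMK.integral_rieszMeasure (positiveFunctional Φ φ)
    (CompactlySupportedContinuousMap.continuousMapEquiv f)
  have h1 : ∫ x, f x ∂(calculusMeasure Φ φ) = (inner ℂ φ (Φ f.toComplex φ)).re := h
  have h2 : (inner ℂ φ (Φ f.toComplex φ)).im = 0 := by
    have hs : star f.toComplex = f.toComplex := by
      ext x
      exact Complex.conj_ofReal _
    have hs' : ContinuousLinearMap.adjoint (Φ f.toComplex) = Φ f.toComplex := by
      rw [← ContinuousLinearMap.star_eq_adjoint, ← map_star, hs]
    refine Complex.conj_eq_iff_im.1 ?_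
    rw [inner_conj_symm, ← ContinuousLinearMap.adjoint_inner_right, hs']
  change _ = ∫ x, (f x : ℂ) ∂(calculusMeasure Φ φ)
  rw [integral_complex_ofReal, h1]
  exact Complex.ext (by simp) (by simpa using h2)

theorem ContinuousMap.bddMeas (f : C(X, ℂ)) : BddMeas f := by
  refine ⟨f.continuous.measurable, ‖f‖, fun x => f.norm_coe_le_norm x⟩

theorem represents_continuous (Φ : C(X, ℂ) →⋆ₐ[ℂ] (E →L[ℂ] E)) (f : C(X, ℂ)) :
    Represents (calculusMeasure Φ) f (Φ f) := by
  let a : C(X, ℝ) := ⟨fun x => (f x).re, Complex.continuous_re.comp f.continuous⟩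
  let b : C(X, ℝ) := ⟨fun x => (f x).im, Complex.continuous_im.comp f.continuous⟩
  have e : f = a.toComplex + Complex.I • b.toComplex := by
    ext x
    change f x = ((f x).re : ℂ) + Complex.I * ((f x).im : ℂ)
    rw [mul_comm, Complex.re_add_im]
  have h := (represents_toComplex Φ a).add a.toComplex.bddMeas
    (b.toComplex.bddMeas.const_mul Complex.I) ((represents_toComplex Φ b).smul Complex.I)
  rw [e, map_add, map_smul]
  exact h

theorem calculusMeasure_univ (Φ : C(X, ℂ) →⋆ₐ[ℂ] (E →L[ℂ] E)) (φ : E) :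
    (calculusMeasure Φ φ).real Set.univ = ‖φ‖ ^ 2 := by
  have h := represents_continuous Φ 1 φ
  rw [map_one, one_apply_eq_self, inner_self_eq_norm_sq_to_K] at h
  simp only [ContinuousMap.one_apply, integral_const, Complex.coe_algebraMap] at h
  refine Complex.ofReal_injective ?_
  simpa using h.symm

/-- Riesz–Markov measures represent `Φ`; bounded limits extend it to Borel functions.
Multiplicativity is extended one factor at a time, adjoints exchanging the factors between the two
passes. -/
theorem exists_borel_calculus (Φ : C(X, ℂ) →⋆ₐ[ℂ] (E →L[ℂ] E)) :
    ∃ B : (X → ℂ) → E →L[ℂ] E, (∀ f, BddMeas f → Represents (calculusMeasure Φ) f (B f)) ∧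
      (∀ f : C(X, ℂ), B f = Φ f) ∧
      ∀ f g, BddMeas f → BddMeas g → B (fun x => f x * g x) = B f * B g := by
  have h1 : ∀ f : X → ℂ, BddMeas f → ∃ B, Represents (calculusMeasure Φ) f B := by
    intro f hf
    refine hf.induction_continuous (p := fun f => ∃ B, Represents (calculusMeasure Φ) f B)
      (fun f hf _ => ⟨_, represents_continuous Φ ⟨f, hf⟩⟩) ?_ ?_ ?_
    · rintro f g hf hg ⟨B, hB⟩ ⟨D, hD⟩
      exact ⟨B + D, Represents.add hf hg hB hD⟩
    · rintro c f hf ⟨B, hB⟩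
      exact ⟨c • B, hB.smul c⟩
    · intro F f C hF hC hlim h
      choose B hB using h
      exact Represents.exists_of_tendsto (fun φ => (calculusMeasure_univ Φ φ).le) hF hC hlim hB
  classical
  let B : (X → ℂ) → E →L[ℂ] E := fun f => if hf : BddMeas f then (h1 f hf).choose else 0
  have hB : ∀ f, BddMeas f → Represents (calculusMeasure Φ) f (B f) := by
    intro f hf
    have : B f = (h1 f hf).choose := dif_pos hf
    rw [this]
    exact (h1 f hf).choose_spec
  have hΦ : ∀ f : C(X, ℂ), B f = Φ f := fun f =>
    (hB f f.bddMeas).unique (represents_continuous Φ f)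
  refine ⟨B, hB, hΦ, ?_⟩
  have hconj : ∀ f, BddMeas f → B (fun x => starRingEnd ℂ (f x)) =
      ContinuousLinearMap.adjoint (B f) := fun f hf => (hB _ hf.conj).unique (hB f hf).adjoint
  have key : ∀ g, BddMeas g → (∀ f : C(X, ℂ), B (fun x => f x * g x) = B f * B g) →
      ∀ {f}, BddMeas f → B (fun x => f x * g x) = B f * B g := by
    intro g hg hc f hf
    refine hf.induction_continuous (p := fun f => B (fun x => f x * g x) = B f * B g)
      (fun f hf _ => hc ⟨f, hf⟩) ?_ ?_ ?_
    · intro f f' hf hf' h h'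
      have e1 := (hB _ (hf.add hf')).unique (Represents.add hf hf' (hB f hf) (hB f' hf'))
      have e2 := (hB _ ((hf.mul hg).add (hf'.mul hg))).unique
        (Represents.add (hf.mul hg) (hf'.mul hg) (hB _ (hf.mul hg)) (hB _ (hf'.mul hg)))
      simp_rw [add_mul]
      rw [e1, e2, h, h', add_mul]
    · intro c f hf h
      have e1 := (hB _ (hf.const_mul c)).unique ((hB f hf).smul c)
      have e2 := (hB _ ((hf.mul hg).const_mul c)).unique ((hB _ (hf.mul hg)).smul c)
      simp_rw [mul_assoc]
      rw [e1, e2, h, smul_mul_assoc]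
    · intro F f C hF hC hlim h
      have hf : BddMeas f := BddMeas.of_tendsto hF hC hlim
      refine (hB _ (hf.mul hg)).unique (Represents.mul_of_tendsto hg hF hC hlim
        (fun n => hB _ (hF n)) (hB f hf) fun n => ?_)
      rw [← h n]
      exact hB _ ((hF n).mul hg)
  have key2 : ∀ (g : C(X, ℂ)) {f}, BddMeas f → B (fun x => f x * g x) = B f * B g := by
    intro g
    refine key g g.bddMeas fun f => ?_
    rw [hΦ f, hΦ g, ← map_mul, ← hΦ]
    rfl
  intro f g hf hg
  refine key g hg (fun f => ?_) hf
  have := key2 (star f) hg.conj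
  have h3 := congrArg ContinuousLinearMap.adjoint this
  rw [← hconj _ (hg.conj.mul (star f).bddMeas), hconj _ hg, hΦ (star f), map_star,
    ContinuousLinearMap.star_eq_adjoint, ContinuousLinearMap.mul_def,
    ContinuousLinearMap.adjoint_comp, ContinuousLinearMap.adjoint_adjoint,
    ContinuousLinearMap.adjoint_adjoint, ← ContinuousLinearMap.mul_def, ← hΦ f] at h3
  rw [← h3]
  congr 1
  ext x
  simp [mul_comm]

end BorelCalculus

section PVMOfCalculus

variable {E : Type*} [NormedAddCommGroup E] [InnerProductSpace ℂ E] [CompleteSpace E]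
  {X : Type*} [MeasurableSpace X]

/-- A multiplicative Borel calculus on `X` is pushed forward to a projection-valued measure on `ℝ`
by a measurable function. -/
theorem exists_pvm_of_calculus {μ : E → Measure X} [hμ : ∀ φ, IsFiniteMeasure (μ φ)]
    {B : (X → ℂ) → E →L[ℂ] E} (hB : ∀ f, BddMeas f → Represents μ f (B f))
    (hone : B (fun _ => 1) = 1)
    (hmul : ∀ f g, BddMeas f → BddMeas g → B (fun x => f x * g x) = B f * B g)
    {m : X → ℝ} (hm : Measurable m) :
    ∃ P : PVM E, ∀ f : ℝ → ℂ, BddMeas f → P.integral f = B fun x => f (m x) := by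
  classical
  have hb : ∀ s : Set X, MeasurableSet s → BddMeas (s.indicator fun _ => (1 : ℂ)) := fun s hs =>
    (BddMeas.const 1).indicator hs
  have hproj : ∀ s : Set X, MeasurableSet s →
      IsStarProjection (B (s.indicator fun _ => (1 : ℂ))) := by
    intro s hs
    constructor
    · rw [IsIdempotentElem, ← hmul _ _ (hb s hs) (hb s hs)]
      congr 1
      ext x
      by_cases hx : x ∈ s <;> simp [hx]
    · rw [IsSelfAdjoint, ContinuousLinearMap.star_eq_adjoint]
      refine ((hB _ (hb s hs)).adjoint).unique ?_
      convert hB _ (hb s hs) using 1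
      ext x
      by_cases hx : x ∈ s <;> simp [hx]
  have hnorm : ∀ s : Set X, MeasurableSet s → ∀ φ,
      ‖B (s.indicator fun _ => (1 : ℂ)) φ‖ ^ 2 = (μ φ).real s := by
    intro s hs φ
    have h := hB _ (hb s hs) φ
    have h1 := hproj s hs
    have h2 : inner ℂ (B (s.indicator fun _ => (1 : ℂ)) φ) (B (s.indicator fun _ => (1 : ℂ)) φ) =
        inner ℂ φ (B (s.indicator fun _ => (1 : ℂ)) φ) := by
      rw [← ContinuousLinearMap.adjoint_inner_right, ← ContinuousLinearMap.star_eq_adjoint,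
        h1.2.star_eq, ← mul_apply_eq_comp, h1.1.eq]
    rw [integral_indicator_const _ hs, ← h2, inner_self_eq_norm_sq_to_K] at h
    refine Complex.ofReal_injective ?_
    simpa using h
  let pr : Set ℝ → E →L[ℂ] E := fun s =>
    if MeasurableSet s then B ((m ⁻¹' s).indicator fun _ => 1) else 0
  have hpr : ∀ s, MeasurableSet s → pr s = B ((m ⁻¹' s).indicator fun _ => 1) := fun s hs =>
    if_pos hs
  let P : PVM E :=
    { proj := pr
      isStarProjection := fun s hs => by
        rw [hpr s hs]
        exact hproj _ (hm hs)
      not_measurable := fun s hs => if_neg hs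
      proj_univ := by
        rw [hpr _ MeasurableSet.univ, Set.preimage_univ, Set.indicator_univ, hone]
      proj_inter := fun s t hs ht => by
        rw [hpr _ hs, hpr _ ht, hpr _ (hs.inter ht), ← hmul _ _ (hb _ (hm hs)) (hb _ (hm ht))]
        congr 1
        ext x
        by_cases hx : m x ∈ s <;> by_cases hx' : m x ∈ t <;> simp [hx, hx']
      hasSum_proj := by
        intro s hs hd φ
        have hd' : Pairwise (Function.onFun Disjoint fun n => m ⁻¹' (s n)) := fun i j hij =>
          (hd hij).preimage m
        have hms : ∀ n, MeasurableSet (m ⁻¹' (s n)) := fun n => hm (hs n)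
        have hU : MeasurableSet (⋃ n, s n) := MeasurableSet.iUnion hs
        have hsum : HasSum (fun n => (μ φ).real (m ⁻¹' (s n))) ((μ φ).real (m ⁻¹' (⋃ n, s n))) := by
          rw [Set.preimage_iUnion]
          have h := ENNReal.hasSum_toReal (f := fun n => μ φ (m ⁻¹' (s n))) (by
            rw [← measure_iUnion hd' hms]
            exact measure_ne_top _ _)
          rw [← ENNReal.tsum_toReal_eq fun n => measure_ne_top _ _] at h
          rw [measureReal_def, measure_iUnion hd' hms]
          exact h
        -- The remainder of the series is itself the projection of a tail set, so its squared norm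
        -- on `φ` is the measure of that tail and tends to zero.
        have hdiff : ∀ A : Finset ℕ, pr (⋃ n, s n) - ∑ n ∈ A, pr (s n) =
            B ((m ⁻¹' ((⋃ n, s n) \ ⋃ n ∈ A, s n)).indicator fun _ => 1) := by
          intro A
          refine Represents.clm_ext fun ψ => ?_
          have hA : MeasurableSet (⋃ n ∈ A, s n) := Finset.measurableSet_biUnion _ fun i _ => hs i
          have e1 : (μ ψ).real (⋃ n ∈ A, m ⁻¹' (s n)) = ∑ n ∈ A, (μ ψ).real (m ⁻¹' (s n)) :=
            measureReal_biUnion_finset (fun i _ j _ hij => hd' hij) fun i _ => hms i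
          rw [hB _ (hb _ (hm (hU.diff hA))), integral_indicator_const _ (hm (hU.diff hA)),
            Set.preimage_sdiff, Set.preimage_iUnion₂,
            measureReal_sdiff (by
              rw [← Set.preimage_iUnion₂]
              exact Set.preimage_mono (Set.iUnion₂_subset_iUnion _ _))
              (Finset.measurableSet_biUnion _ fun i _ => hms i), e1]
          rw [sub_apply, sum_apply, inner_sub_right, inner_sum, hpr _ hU,
            hB _ (hb _ (hm hU)), integral_indicator_const _ (hm hU)]
          have e2 : ∀ n, inner ℂ ψ (pr (s n) ψ) = ((μ ψ).real (m ⁻¹' (s n)) : ℂ) := by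
            intro n
            rw [hpr _ (hs n), hB _ (hb _ (hms n)), integral_indicator_const _ (hms n)]
            simp
          simp [e2]
        have h0 : Tendsto (fun A : Finset ℕ => ‖pr (⋃ n, s n) φ - ∑ n ∈ A, pr (s n) φ‖ ^ 2) atTop
            (𝓝 0) := by
          have e : ∀ A : Finset ℕ, ‖pr (⋃ n, s n) φ - ∑ n ∈ A, pr (s n) φ‖ ^ 2 =
              (μ φ).real (m ⁻¹' (⋃ n, s n)) - ∑ n ∈ A, (μ φ).real (m ⁻¹' (s n)) := by
            intro A
            have hA : MeasurableSet (⋃ n ∈ A, s n) := Finset.measurableSet_biUnion _ fun i _ => hs i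
            have e1 : (μ φ).real (⋃ n ∈ A, m ⁻¹' (s n)) = ∑ n ∈ A, (μ φ).real (m ⁻¹' (s n)) :=
              measureReal_biUnion_finset (fun i _ j _ hij => hd' hij) fun i _ => hms i
            rw [← sum_apply, ← sub_apply, hdiff A, hnorm _ (hm (hU.diff hA)),
              Set.preimage_sdiff, Set.preimage_iUnion₂,
              measureReal_sdiff (by
                rw [← Set.preimage_iUnion₂]
                exact Set.preimage_mono (Set.iUnion₂_subset_iUnion _ _))
                (Finset.measurableSet_biUnion _ fun i _ => hms i), e1]
          simp_rw [e]
          have := (tendsto_const_nhds (x := (μ φ).real (m ⁻¹' (⋃ n, s n)))).sub hsum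
          rwa [sub_self] at this
        have h1 : Tendsto (fun A : Finset ℕ => ‖pr (⋃ n, s n) φ - ∑ n ∈ A, pr (s n) φ‖) atTop
            (𝓝 0) := by
          have := (Real.continuous_sqrt.tendsto 0).comp h0
          simpa [Function.comp_def] using this
        rw [HasSum, SummationFilter.unconditional_filter]
        rw [tendsto_iff_norm_sub_tendsto_zero]
        exact h1.congr fun A => norm_sub_rev _ _ }
  have hmeas : ∀ φ, P.measure φ = (μ φ).map m := by
    intro φ
    ext s hs
    have h1 : P.proj s = B ((m ⁻¹' s).indicator fun _ => 1) := hpr s hs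
    rw [P.measure_apply φ hs, Measure.map_apply hm hs, h1, hnorm _ (hm hs), ofReal_measureReal]
  refine ⟨P, fun f hf => P.integral_eq hf fun φ => ?_⟩
  rw [hB _ (hf.comp hm), hmeas, integral_map hm.aemeasurable hf.measurable.aestronglyMeasurable]

end PVMOfCalculus

end

/-! ### The spectral theorem through the resolvent at `i`. -/

noncomputable section

set_option linter.unusedSectionVars false

open Filter Topology

/-- The function `x ↦ (x - i)⁻¹` on the real line. -/
def resolventFun (x : ℝ) : ℂ := ((x : ℂ) - Complex.I)⁻¹

theorem ofReal_sub_I_ne_zero (x : ℝ) : (x : ℂ) - Complex.I ≠ 0 := by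
  intro h
  simpa using congrArg Complex.im h

theorem norm_resolventFun_sq (x : ℝ) : ‖resolventFun x‖ ^ 2 = (x ^ 2 + 1)⁻¹ := by
  rw [resolventFun, norm_inv, inv_pow, ← Complex.normSq_eq_norm_sq, Complex.normSq_apply]
  congr 1
  simp
  ring

theorem resolventFun_bddMeas : BddMeas resolventFun := by
  refine ⟨(by unfold resolventFun; fun_prop), 1, fun x => ?_⟩
  have h := norm_resolventFun_sq x
  have h1 : (x ^ 2 + 1)⁻¹ ≤ (1 : ℝ) := inv_le_one_of_one_le₀ (by nlinarith [sq_nonneg x])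
  rw [← h] at h1
  exact le_of_sq_le_sq (by simpa using h1) zero_le_one

theorem ofReal_mul_resolventFun (x : ℝ) :
    (x : ℂ) * resolventFun x = 1 + Complex.I * resolventFun x := by
  have := ofReal_sub_I_ne_zero x
  rw [resolventFun]
  field_simp
  ring

namespace LinearPMap

variable {E : Type*} [NormedAddCommGroup E] [InnerProductSpace ℂ E] [CompleteSpace E]
  {T : E →ₗ.[ℂ] E}

theorem I_im_ne_zero : Complex.I.im ≠ 0 := by simp

theorem neg_I_im_ne_zero : (-Complex.I).im ≠ 0 := by simp

theorem adjoint_resolventAt_I (hT : IsSelfAdjoint T) :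
    ContinuousLinearMap.adjoint (T.resolventAt Complex.I) = T.resolventAt (-Complex.I) := by
  refine (ContinuousLinearMap.eq_adjoint_iff _ _).2 (fun φ ψ => ?_) |>.symm
  have h := inner_graph_of_isSelfAdjoint hT (resolventAt_mem_graph hT neg_I_im_ne_zero φ)
    (resolventAt_mem_graph hT I_im_ne_zero ψ)
  simp only [inner_add_left, inner_add_right, inner_smul_left, inner_smul_right,
    _root_.map_neg, Complex.conj_I] at h
  linear_combination -h

theorem resolventAt_I_sub (hT : IsSelfAdjoint T) :
    T.resolventAt Complex.I - T.resolventAt (-Complex.I) =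
      (2 * Complex.I) • (T.resolventAt Complex.I * T.resolventAt (-Complex.I)) := by
  ext φ
  have h := resolventAt_sub hT I_im_ne_zero (resolventAt_mem_graph hT neg_I_im_ne_zero φ)
  simp only [_root_.map_sub, _root_.map_add, _root_.map_smul] at h
  simp only [_root_.sub_apply, _root_.smul_apply, mul_apply_eq_comp]
  rw [← sub_eq_zero] at h ⊢
  rw [← h]
  module

theorem resolventAt_I_sub' (hT : IsSelfAdjoint T) :
    T.resolventAt Complex.I - T.resolventAt (-Complex.I) =
      (2 * Complex.I) • (T.resolventAt (-Complex.I) * T.resolventAt Complex.I) := by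
  ext φ
  have h := resolventAt_sub hT neg_I_im_ne_zero (resolventAt_mem_graph hT I_im_ne_zero φ)
  simp only [_root_.map_sub, _root_.map_add, _root_.map_smul] at h
  simp only [_root_.sub_apply, _root_.smul_apply, mul_apply_eq_comp]
  rw [← sub_eq_zero] at h ⊢
  rw [← neg_eq_zero, ← h]
  module

theorem isStarNormal_resolventAt_I (hT : IsSelfAdjoint T) :
    IsStarNormal (T.resolventAt Complex.I) := by
  constructor
  rw [Commute, SemiconjBy, ContinuousLinearMap.star_eq_adjoint, adjoint_resolventAt_I hT]
  have h := (resolventAt_I_sub' hT).symm.trans (resolventAt_I_sub hT)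
  exact smul_right_injective _ (by simp : 2 * Complex.I ≠ 0) h

theorem resolventAt_I_injective (hT : IsSelfAdjoint T) {φ : E}
    (h : T.resolventAt Complex.I φ = 0) : φ = 0 := by
  have := resolventAt_mem_graph hT I_im_ne_zero φ
  rw [h, smul_zero, add_zero] at this
  exact T.graph_fst_eq_zero_snd this rfl

/-- The resolvent `R` is normal, and its calculus is transported to the line by `z ↦ Re (1/z)`,
which inverts `x ↦ (x - i)⁻¹` on the spectrum away from `0`. -/
theorem exists_pvm_integral_eq_resolventAt (hT : IsSelfAdjoint T) :
    ∃ P : PVM E, P.integral resolventFun = T.resolventAt Complex.I := by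
  set R := T.resolventAt Complex.I with hR
  have hN : IsStarNormal R := isStarNormal_resolventAt_I hT
  let Φ : C(spectrum ℂ R, ℂ) →⋆ₐ[ℂ] (E →L[ℂ] E) := cfcHom hN
  let ι : C(spectrum ℂ R, ℂ) := (ContinuousMap.id ℂ).restrict (spectrum ℂ R)
  have hι : Φ ι = R := cfcHom_id hN
  obtain ⟨B, hB, hBΦ, hmul⟩ := exists_borel_calculus Φ
  have hm : Measurable fun z : spectrum ℂ R => ((z : ℂ)⁻¹).re :=
    Complex.measurable_re.comp measurable_subtype_coe.inv
  obtain ⟨P, hP⟩ := exists_pvm_of_calculus hB ((hBΦ 1).trans (_root_.map_one Φ)) hmul hm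
  refine ⟨P, ?_⟩
  rw [hP _ resolventFun_bddMeas]
  -- The identity `R - R* = 2i R R*` confines the spectrum to the circle `z - conj z = 2i |z|²`,
  -- where `1/z` has imaginary part `-1` if `z ≠ 0`.
  have hspec : ∀ z : spectrum ℂ R, (z : ℂ) - starRingEnd ℂ (z : ℂ) =
      2 * Complex.I * (z * starRingEnd ℂ (z : ℂ)) := by
    have h : Φ (ι - star ι) = Φ ((2 * Complex.I) • (ι * star ι)) := by
      rw [_root_.map_sub, _root_.map_smul, _root_.map_mul, map_star, hι, ContinuousLinearMap.star_eq_adjoint, hR,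
        adjoint_resolventAt_I hT, resolventAt_I_sub hT]
    have h' := cfcHom_injective hN h
    intro z
    exact congrArg (fun f : C(spectrum ℂ R, ℂ) => f z) h'
  let S : Set (spectrum ℂ R) := {z | (z : ℂ) = 0}
  have hS : MeasurableSet S := measurable_subtype_coe (measurableSet_singleton 0)
  have hS1 : BddMeas (S.indicator fun _ => (1 : ℂ)) := (BddMeas.const 1).indicator hS
  -- The point `0` may lie in the spectrum but carries no mass: `R B(1_{0}) = 0` and `R` is
  -- injective.
  have hZ : B (S.indicator fun _ => (1 : ℂ)) = 0 := by
    have h1 := hmul ι _ ι.bddMeas hS1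
    have h2 : (fun z => ι z * S.indicator (fun _ => (1 : ℂ)) z) = ((0 : C(spectrum ℂ R, ℂ)) : _) := by
      ext z
      by_cases hz : z ∈ S
      · have : ι z = 0 := hz
        simp [this]
      · simp [hz]
    rw [h2, hBΦ, hBΦ, _root_.map_zero, hι] at h1
    ext φ
    exact resolventAt_I_injective hT (congrArg (fun L : E →L[ℂ] E => L φ) h1.symm)
  -- At `z = 0` the convention `0⁻¹ = 0` yields `resolventFun 0 = i`; the second summand records
  -- this discrepancy, which `hZ` removes.
  have hfun : (fun z : spectrum ℂ R => resolventFun ((z : ℂ)⁻¹).re) =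
      fun z => ι z + Complex.I * S.indicator (fun _ => (1 : ℂ)) z := by
    ext z
    change _ = (z : ℂ) + _
    by_cases hz : z ∈ S
    · have h0 : (z : ℂ) = 0 := hz
      rw [Set.indicator_of_mem hz, h0, resolventFun]
      simp
    · have h0 : (z : ℂ) ≠ 0 := hz
      rw [Set.indicator_of_notMem hz, mul_zero, add_zero, resolventFun]
      have h0' : starRingEnd ℂ (z : ℂ) ≠ 0 := (map_ne_zero _).2 h0
      have h1 : starRingEnd ℂ (z : ℂ)⁻¹ - (z : ℂ)⁻¹ = 2 * Complex.I := by
        rw [map_inv₀]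
        field_simp
        linear_combination hspec z
      have h2 : ((z : ℂ)⁻¹).im = -1 := by
        have := congrArg Complex.im h1
        simp only [Complex.sub_im, Complex.conj_im, Complex.mul_im, Complex.re_ofNat,
          Complex.im_ofNat, Complex.I_im, Complex.I_re] at this
        linarith
      have h3 : (((z : ℂ)⁻¹).re : ℂ) - Complex.I = (z : ℂ)⁻¹ := by
        apply Complex.ext
        · simp
        · rw [h2]
          simp
      rw [h3, inv_inv]
  rw [hfun]
  have h := Represents.add ι.bddMeas (hS1.const_mul Complex.I) (hB ι ι.bddMeas)
    ((hB _ hS1).smul Complex.I)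
  rw [hZ, smul_zero, add_zero, hBΦ, hι] at h
  exact (hB _ (ι.bddMeas.add (hS1.const_mul Complex.I))).unique h

theorem integrable_sq_measure_resolvent (P : PVM E) (η : E) :
    Integrable (fun x : ℝ => x ^ 2) (P.measure (P.integral resolventFun η)) := by
  rw [P.integrable_measure_integral_iff resolventFun_bddMeas]
  refine Integrable.of_bound (C := 1) ?_ (ae_of_all _ fun x => ?_)
  · exact ((resolventFun_bddMeas.measurable.norm.pow_const 2).mul
      (measurable_id.pow_const 2)).aestronglyMeasurable
  · rw [norm_resolventFun_sq, Real.norm_of_nonneg (by positivity), inv_mul_le_one₀ (by positivity)]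
    linarith

theorem inner_integral_resolvent (P : PVM E) (η : E) :
    inner ℂ (P.integral resolventFun η) (η + Complex.I • P.integral resolventFun η) =
      ((∫ x, x ∂(P.measure (P.integral resolventFun η)) : ℝ) : ℂ) := by
  have hr := resolventFun_bddMeas
  have h1 : η + Complex.I • P.integral resolventFun η =
      P.integral (fun x => 1 + Complex.I * resolventFun x) η := by
    rw [P.integral_add (BddMeas.const 1) (hr.const_mul _), P.integral_const_mul _ hr,
      P.integral_one]
    rfl
  have hb : BddMeas fun x => 1 + Complex.I * resolventFun x :=
    (BddMeas.const 1).add (hr.const_mul _)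
  rw [h1, ← ContinuousLinearMap.adjoint_inner_right, ← P.integral_conj hr,
    P.integral_apply_integral hr.conj hb, P.inner_integral (hr.conj.mul hb),
    P.integral_measure_integral hr, ← integral_complex_ofReal]
  congr 1
  ext x
  rw [← ofReal_mul_resolventFun, Complex.ofReal_mul, Complex.ofReal_pow, ← Complex.conj_mul']
  ring

theorem isSpectralMeasure_of_integral_eq (hT : IsSelfAdjoint T) {P : PVM E}
    (hP : P.integral resolventFun = T.resolventAt Complex.I) : IsSpectralMeasure T P := by
  have hr := resolventFun_bddMeas
  have hrange : ∀ φ : T.domain, ∃ η, (φ : E) = P.integral resolventFun η ∧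
      T φ = η + Complex.I • P.integral resolventFun η := by
    intro φ
    refine ⟨T φ - Complex.I • (φ : E), ?_, ?_⟩
    · rw [hP, resolventAt_sub hT I_im_ne_zero (T.mem_graph φ)]
    · rw [hP, resolventAt_sub hT I_im_ne_zero (T.mem_graph φ), sub_add_cancel]
  refine ⟨fun φ => ⟨fun hφ => ?_, fun hφ => ?_⟩, fun φ => ?_⟩
  · obtain ⟨η, h1, -⟩ := hrange ⟨φ, hφ⟩
    rw [show φ = _ from h1]
    exact integrable_sq_measure_resolvent P η
  -- Truncation to `[-n, n]` gives graph elements `(a n, b n)` with `a n → φ` weakly and `‖b n‖ ≤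
  -- √I0`. Hence `|⟨φ, T ψ⟩| ≤ √I0 ‖ψ‖`, so `φ` lies in the domain of `T* = T`.
  · set I0 : ℝ := ∫ x, x ^ 2 ∂(P.measure φ) with hI0
    let J : ℕ → Set ℝ := fun n => Set.Icc (-(n : ℝ)) n
    have hJ : ∀ n, MeasurableSet (J n) := fun n => measurableSet_Icc
    have hJ1 : ∀ n, BddMeas ((J n).indicator fun _ => (1 : ℂ)) := fun n =>
      (BddMeas.const 1).indicator (hJ n)
    have hJx : ∀ n, BddMeas ((J n).indicator fun x : ℝ => (x : ℂ)) := fun n =>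
      ⟨Complex.measurable_ofReal.indicator (hJ n), n, fun x => by
        by_cases hx : x ∈ J n
        · rw [Set.indicator_of_mem hx, Complex.norm_real]
          exact abs_le.2 hx
        · rw [Set.indicator_of_notMem hx, norm_zero]
          exact Nat.cast_nonneg n⟩
    let a : ℕ → E := fun n => P.integral ((J n).indicator fun _ => (1 : ℂ)) φ
    let b : ℕ → E := fun n => P.integral ((J n).indicator fun x : ℝ => (x : ℂ)) φ
    have hab : ∀ n, (a n, b n) ∈ T.graph := by
      intro n
      rw [mem_graph_iff_resolventAt hT I_im_ne_zero, ← hP]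
      have e : b n - Complex.I • a n = P.integral (fun x => (J n).indicator (fun x : ℝ => (x : ℂ)) x -
          Complex.I * (J n).indicator (fun _ => (1 : ℂ)) x) φ := by
        rw [P.integral_sub (hJx n) ((hJ1 n).const_mul _), P.integral_const_mul _ (hJ1 n)]
        rfl
      rw [e, P.integral_apply_integral hr ((hJx n).sub ((hJ1 n).const_mul _))]
      congr 2
      ext x
      by_cases hx : x ∈ J n
      · simp only [Set.indicator_of_mem hx, mul_one, resolventFun]
        exact inv_mul_cancel₀ (ofReal_sub_I_ne_zero x)
      · simp [hx]
    have hb : ∀ n, ‖b n‖ ≤ Real.sqrt I0 := by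
      intro n
      refine Real.le_sqrt_of_sq_le ?_
      rw [P.norm_integral_sq (hJx n)]
      refine integral_mono_of_nonneg (ae_of_all _ fun x => by positivity) hφ (ae_of_all _ fun x => ?_)
      by_cases hx : x ∈ J n
      · simp [hx]
      · simp [hx, sq_nonneg]
    have hlim : ∀ ψ : E, Tendsto (fun n => inner ℂ ψ (a n)) atTop (𝓝 (inner ℂ ψ φ)) := by
      intro ψ
      have h := P.tendsto_inner_integral (f := fun _ => 1) (C := 1) hJ1
        (fun n x => (norm_indicator_le_norm_self _ _).trans (by simp)) (fun x => ?_) ψ φ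
      · rwa [P.integral_one, one_apply_eq_self] at h
      · refine tendsto_const_nhds.congr' ?_
        filter_upwards [eventually_ge_atTop ⌈|x|⌉₊] with n hn
        have : |x| ≤ n := Nat.ceil_le.1 hn
        rw [Set.indicator_of_mem]
        exact abs_le.1 this
    have hmem : φ ∈ T.adjoint.domain := by
      rw [mem_adjoint_domain_iff]
      refine AddMonoidHomClass.continuous_of_bound ((innerₛₗ ℂ φ).comp T.toFun)
        (Real.sqrt I0) fun ψ => ?_
      change ‖inner ℂ φ (T ψ)‖ ≤ Real.sqrt I0 * ‖(ψ : E)‖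
      rw [norm_inner_symm]
      refine le_of_tendsto (hlim (T ψ)).norm (Eventually.of_forall fun n => ?_)
      have e := inner_graph_of_isSelfAdjoint hT (T.mem_graph ψ) (hab n)
      rw [show inner ℂ (T ψ) (a n) = inner ℂ (ψ : E) (b n) from e, mul_comm]
      exact (norm_inner_le_norm _ _).trans (by gcongr; exact hb n)
    rwa [isSelfAdjoint_def.1 hT] at hmem
  · obtain ⟨η, h1, h2⟩ := hrange φ
    rw [h2, h1]
    exact inner_integral_resolvent P η

theorem exists_isSpectralMeasure (hT : IsSelfAdjoint T) : ∃ P, IsSpectralMeasure T P := by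
  obtain ⟨P, hP⟩ := exists_pvm_integral_eq_resolventAt hT
  exact ⟨P, isSpectralMeasure_of_integral_eq hT hP⟩

/-- `spectralMeasure` is a choice, so its resolvent identity must come from the defining properties
alone. These only control a quadratic form; polarization shows that the defect `N` of the identity
takes values in the kernel of `S*`, which is trivial because `‖S* η‖² = ∫ (1 + x²)⁻¹ dμ_η`. -/
theorem integral_resolventFun_of_isSpectralMeasure (hT : IsSelfAdjoint T) {P : PVM E}
    (hP : IsSpectralMeasure T P) : P.integral resolventFun = T.resolventAt Complex.I := by
  set S := P.integral resolventFun with hS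
  have hdom : ∀ φ, S φ ∈ T.domain := fun φ =>
    (hP.mem_domain_iff _).2 (integrable_sq_measure_resolvent P φ)
  let N : E →ₗ[ℂ] E := T.toFun.comp (S.toLinearMap.codRestrict T.domain hdom) -
    (LinearMap.id + Complex.I • S.toLinearMap)
  have hN : ∀ φ, N φ = T ⟨S φ, hdom φ⟩ - (φ + Complex.I • S φ) := fun φ => rfl
  have h0 : ∀ φ, inner ℂ (S φ) (N φ) = 0 := by
    intro φ
    rw [hN, inner_sub_right, inner_integral_resolvent P φ, sub_eq_zero]
    exact hP.inner_apply ⟨S φ, hdom φ⟩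
  have h1 : ∀ φ ψ, inner ℂ (S φ) (N ψ) = 0 := by
    intro φ ψ
    have e1 := h0 (φ + ψ)
    have e2 := h0 (φ + Complex.I • ψ)
    simp only [_root_.map_add, _root_.map_smul, inner_add_left, inner_add_right, inner_smul_left,
      inner_smul_right, Complex.conj_I] at e1 e2
    simp only [h0 φ, h0 ψ, mul_zero, add_zero, zero_add] at e1 e2
    have : (2 : ℂ) * inner ℂ (S φ) (N ψ) = 0 := by
      linear_combination e1 - Complex.I * e2 +
        (inner ℂ (S φ) (N ψ) - inner ℂ (S ψ) (N φ)) * Complex.I_sq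
    simpa using this
  have hr := resolventFun_bddMeas
  have h2 : ∀ φ, N φ = 0 := by
    intro φ
    have e : P.integral (fun x => starRingEnd ℂ (resolventFun x)) (N φ) = 0 := by
      rw [P.integral_conj hr]
      refine ext_inner_left ℂ fun ψ => ?_
      rw [ContinuousLinearMap.adjoint_inner_right, h1, inner_zero_right]
    have e2 := P.norm_integral_sq hr.conj (N φ)
    rw [e, norm_zero, zero_pow two_ne_zero] at e2
    simp only [RCLike.norm_conj, norm_resolventFun_sq] at e2
    have e3 := (integral_eq_zero_iff_of_nonneg (fun x => by positivity) (by
      have := (hr.conj.mul hr).integrable (P.measure (N φ))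
      refine this.re.congr (ae_of_all _ fun x => ?_)
      change (starRingEnd ℂ (resolventFun x) * resolventFun x).re = _
      rw [Complex.conj_mul', ← Complex.ofReal_pow, norm_resolventFun_sq, Complex.ofReal_re])).1 e2.symm
    have e4 : P.measure (N φ) Set.univ = 0 := by
      refine measure_mono_null (fun x _ => ?_) e3
      have : (x ^ 2 + 1 : ℝ)⁻¹ ≠ 0 := by positivity
      exact this
    rwa [P.measure_eq_zero_iff _ MeasurableSet.univ, P.proj_univ, one_apply_eq_self] at e4
  ext φ
  have hg := T.mem_graph ⟨S φ, hdom φ⟩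
  have h3 := h2 φ
  rw [hN, sub_eq_zero] at h3
  rw [h3] at hg
  have := resolventAt_sub hT I_im_ne_zero hg
  simpa using this.symm

theorem isSpectralMeasure_spectralMeasure (hT : IsSelfAdjoint T) :
    IsSpectralMeasure T T.spectralMeasure := by
  have h := exists_isSpectralMeasure hT
  have e : T.spectralMeasure = h.choose := dif_pos h
  rw [e]
  exact h.choose_spec

theorem spectralMeasure_integral_resolventFun (hT : IsSelfAdjoint T) :
    T.spectralMeasure.integral resolventFun = T.resolventAt Complex.I :=
  integral_resolventFun_of_isSpectralMeasure hT (isSpectralMeasure_spectralMeasure hT)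

end LinearPMap

end

/-! ### The part of a self-adjoint operator in a spectral subspace. -/

noncomputable section

set_option linter.unusedSectionVars false

open Filter Topology

namespace PVM

variable {E : Type*} [NormedAddCommGroup E] [InnerProductSpace ℂ E] [CompleteSpace E] (P : PVM E)

theorem mem_range_iff {s : Set ℝ} {φ : E} : φ ∈ P.range s ↔ P.proj s φ = φ := by
  constructor
  · rintro ⟨ψ, rfl⟩
    exact congrArg (fun L : E →L[ℂ] E => L ψ) (P.isStarProjection_proj s).1
  · intro h
    exact ⟨φ, h⟩

theorem integral_mem_range {s : Set ℝ} (hs : MeasurableSet s) {f : ℝ → ℂ} (hf : BddMeas f) {φ : E}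
    (hφ : φ ∈ P.range s) : P.integral f φ ∈ P.range s := by
  have hs1 : BddMeas (s.indicator fun _ => (1 : ℂ)) := (BddMeas.const 1).indicator hs
  rw [mem_range_iff] at hφ ⊢
  nth_rewrite 2 [← hφ]
  rw [← P.integral_indicator_one hs, P.integral_apply_integral hs1 hf,
    P.integral_apply_integral hf hs1]
  simp_rw [mul_comm]

/-- If a projection-valued measure on a subspace has the same integral of `(x - i)⁻¹` as `P`, then
its scalar spectral measures coincide with those of `P`. -/
theorem measure_eq_of_integral_resolventFun_eq {K : Submodule ℂ E} [CompleteSpace K] (P' : PVM K)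
    (hK : ∀ f, BddMeas f → ∀ u ∈ K, P.integral f u ∈ K)
    (h : ∀ u : K, (P'.integral resolventFun u : E) = P.integral resolventFun u) (u : K) :
    P'.measure u = P.measure (u : E) := by
  have hb : ∀ f : BoundedContinuousFunction ℝ ℂ, BddMeas f := fun f =>
    ⟨f.continuous.measurable, ‖f‖, f.norm_coe_le_norm⟩
  -- The functions on which both calculi agree form a star algebra containing the injective function
  -- `(x - i)⁻¹`; a point-separating star algebra of bounded continuous functions determines a
  -- finite measure. Invariance of `K` is what gives closure under `star`.
  let 𝒜 : StarSubalgebra ℂ (BoundedContinuousFunction ℝ ℂ) :=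
    { carrier := {f | ∀ u : K, (P'.integral f u : E) = P.integral f u}
      mul_mem' := fun {f g} hf hg u => by
        have e : ((f * g : BoundedContinuousFunction ℝ ℂ) : ℝ → ℂ) = fun x => f x * g x := rfl
        rw [e, ← P'.integral_apply_integral (hb f) (hb g), hf,
          hg, ← P.integral_apply_integral (hb f) (hb g)]
      add_mem' := fun {f g} hf hg u => by
        have e : ((f + g : BoundedContinuousFunction ℝ ℂ) : ℝ → ℂ) = fun x => f x + g x := rfl
        rw [e, P'.integral_add (hb f) (hb g), P.integral_add (hb f) (hb g), add_apply, add_apply,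
          Submodule.coe_add, hf, hg]
      algebraMap_mem' := fun c u => by
        have e : ((algebraMap ℂ (BoundedContinuousFunction ℝ ℂ) c : BoundedContinuousFunction ℝ ℂ) :
            ℝ → ℂ) = fun _ => c := by
          ext x
          simp [Algebra.algebraMap_eq_smul_one]
        rw [e, P'.integral_const, P.integral_const]
        rfl
      star_mem' := fun {f} hf u => by
        have e : ((star f : BoundedContinuousFunction ℝ ℂ) : ℝ → ℂ) =
            fun x => starRingEnd ℂ (f x) := rfl
        rw [e]
        have e2 : P'.integral (fun x => starRingEnd ℂ (f x)) u =
            ⟨P.integral (fun x => starRingEnd ℂ (f x)) u, hK _ (hb f).conj u u.2⟩ := by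
          refine ext_inner_left ℂ fun v => ?_
          rw [P'.integral_conj (hb f), ContinuousLinearMap.adjoint_inner_right,
            Submodule.coe_inner, hf v, Submodule.coe_inner]
          change _ = inner ℂ (v : E) (P.integral (fun x => starRingEnd ℂ (f x)) u)
          rw [P.integral_conj (hb f), ContinuousLinearMap.adjoint_inner_right]
        rw [e2] }
  let ρ : BoundedContinuousFunction ℝ ℂ := BoundedContinuousFunction.ofNormedAddCommGroup
    resolventFun (by
      unfold resolventFun
      exact Continuous.inv₀ (by fun_prop) ofReal_sub_I_ne_zero) 1 (fun x => by
      have h := norm_resolventFun_sq x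
      have h1 : (x ^ 2 + 1)⁻¹ ≤ (1 : ℝ) := inv_le_one_of_one_le₀ (by nlinarith [sq_nonneg x])
      rw [← h] at h1
      exact le_of_sq_le_sq (by simpa using h1) zero_le_one)
  have hρ : ρ ∈ 𝒜 := h
  refine ext_of_forall_mem_subalgebra_integral_eq_of_polish (𝕜 := ℂ) (A := 𝒜) ?_ fun f hf => ?_
  · intro x y hxy
    refine ⟨resolventFun, ⟨_, ⟨ρ, hρ, rfl⟩, rfl⟩, fun he => hxy ?_⟩
    have he' : (x : ℂ) - Complex.I = (y : ℂ) - Complex.I := inv_injective he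
    exact_mod_cast sub_left_injective he'
  · rw [← P'.inner_integral (hb f), ← P.inner_integral (hb f), Submodule.coe_inner, hf]

end PVM

namespace LinearPMap

variable {E : Type*} [NormedAddCommGroup E] [InnerProductSpace ℂ E] [CompleteSpace E]
  {T : E →ₗ.[ℂ] E}

theorem mem_graph_restrictTo (K : Submodule ℂ E) {u w : K} :
    (u, w) ∈ (T.restrictTo K).graph ↔ ((u : E), (w : E)) ∈ T.graph := by
  rw [restrictTo, Submodule.toLinearPMap_graph_eq]
  · rfl
  · rintro ⟨x, y⟩ hx h0
    have hx' : ((x : E), (y : E)) ∈ T.graph := hx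
    have h0 : x = 0 := h0
    exact Subtype.ext (T.graph_fst_eq_zero_snd hx' (by simp [h0]))

theorem isSelfAdjoint_restrictTo (hT : IsSelfAdjoint T) {K : Submodule ℂ E} [CompleteSpace K]
    (h1 : ∀ u ∈ K, T.resolventAt Complex.I u ∈ K)
    (h2 : ∀ u ∈ K, T.resolventAt (-Complex.I) u ∈ K) : IsSelfAdjoint (T.restrictTo K) := by
  have hsurj : ∀ z : ℂ, z.im ≠ 0 → (∀ u ∈ K, T.resolventAt z u ∈ K) → ∀ η : K,
      ∃ u : (T.restrictTo K).domain, T.restrictTo K u - z • (u : K) = η := by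
    intro z hz hK η
    let v : K := ⟨T.resolventAt z η, hK η η.2⟩
    have hv : (v, η + z • v) ∈ (T.restrictTo K).graph :=
      (mem_graph_restrictTo K).2 (resolventAt_mem_graph hT hz (η : E))
    obtain ⟨u, hu, hu'⟩ := (mem_graph_iff _).1 hv
    refine ⟨u, ?_⟩
    have hu : (u : K) = v := hu
    have hu' : T.restrictTo K u = η + z • v := hu'
    rw [hu, hu', add_sub_cancel_right]
  refine isSelfAdjoint_of_forall_exists (fun u v => ?_) (hsurj _ I_im_ne_zero h1) fun η => ?_
  · exact inner_graph_of_isSelfAdjoint hT ((mem_graph_restrictTo K).1 (mem_graph _ u))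
      ((mem_graph_restrictTo K).1 (mem_graph _ v))
  · obtain ⟨u, hu⟩ := hsurj _ neg_I_im_ne_zero h2 η
    refine ⟨u, ?_⟩
    rwa [neg_smul, sub_neg_eq_add] at hu

/-- The part of a self-adjoint operator in a spectral subspace is self-adjoint, and its scalar
spectral measures are those of the operator. -/
theorem isSelfAdjoint_restrictTo_range (hT : IsSelfAdjoint T) {s : Set ℝ} (hs : MeasurableSet s) :
    IsSelfAdjoint (T.restrictTo (T.spectralMeasure.range s)) ∧
      ∀ u : T.spectralMeasure.range s,
        (T.restrictTo (T.spectralMeasure.range s)).spectralMeasure.measure u =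
          T.spectralMeasure.measure (u : E) := by
  set P := T.spectralMeasure with hP
  have hr := resolventFun_bddMeas
  have hPr : P.integral resolventFun = T.resolventAt Complex.I :=
    spectralMeasure_integral_resolventFun hT
  have hK : ∀ f, BddMeas f → ∀ u ∈ P.range s, P.integral f u ∈ P.range s := fun f hf u hu =>
    P.integral_mem_range hs hf hu
  have h1 : ∀ u ∈ P.range s, T.resolventAt Complex.I u ∈ P.range s := by
    rw [← hPr]
    exact hK _ hr
  have h2 : ∀ u ∈ P.range s, T.resolventAt (-Complex.I) u ∈ P.range s := by
    rw [← adjoint_resolventAt_I hT, ← hPr, ← P.integral_conj hr]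
    exact hK _ hr.conj
  have hsa := isSelfAdjoint_restrictTo hT h1 h2
  refine ⟨hsa, P.measure_eq_of_integral_resolventFun_eq _ hK fun u => ?_⟩
  rw [spectralMeasure_integral_resolventFun hsa, hPr]
  have hv : ((⟨T.resolventAt Complex.I u, h1 u u.2⟩ : P.range s),
      u + Complex.I • (⟨T.resolventAt Complex.I u, h1 u u.2⟩ : P.range s)) ∈
      (T.restrictTo (P.range s)).graph :=
    (mem_graph_restrictTo _).2 (resolventAt_mem_graph hT I_im_ne_zero (u : E))
  have := resolventAt_sub hsa I_im_ne_zero hv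
  rw [add_sub_cancel_right] at this
  exact congrArg Subtype.val this

end LinearPMap

end

/-! ### The unitary group of `A`, the class `C¹(A)` and the existence of the commutator. -/

noncomputable section

set_option linter.unusedSectionVars false

open Filter Topology

/-- The sequence `1, 1/2, 1/3, …` of positive times. -/
def smallTime (n : ℕ) : ℝ := 1 / ((n : ℝ) + 1)

theorem smallTime_pos (n : ℕ) : 0 < smallTime n := Nat.one_div_pos_of_nat

theorem tendsto_smallTime : Tendsto smallTime atTop (𝓝[≠] 0) :=
  tendsto_nhdsWithin_of_tendsto_nhds_of_eventually_within _
    tendsto_one_div_add_atTop_nhds_zero_nat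
    (Eventually.of_forall fun n => (smallTime_pos n).ne')

theorem norm_exp_I_mul (t x : ℝ) : ‖Complex.exp (Complex.I * t * x)‖ = 1 := by
  have : Complex.I * t * x = ((t * x : ℝ) : ℂ) * Complex.I := by
    push_cast
    ring
  rw [this, Complex.norm_exp_ofReal_mul_I]

theorem bddMeas_exp (t : ℝ) : BddMeas fun x : ℝ => Complex.exp (Complex.I * t * x) :=
  ⟨by fun_prop, 1, fun x => (norm_exp_I_mul t x).le⟩

theorem norm_exp_sub_one_le (t x : ℝ) : ‖Complex.exp (Complex.I * t * x) - 1‖ ≤ |t| * |x| := by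
  have := Real.norm_exp_I_mul_ofReal_sub_one_le (x := t * x)
  rw [← abs_mul]
  simpa [mul_assoc] using this

theorem tendsto_exp_sub_one_div {τ : ℕ → ℝ} (hτ : Tendsto τ atTop (𝓝[≠] 0)) (x : ℝ) :
    Tendsto (fun n => (Complex.exp (Complex.I * τ n * x) - 1) / τ n) atTop
      (𝓝 (Complex.I * x)) := by
  have h : HasDerivAt (fun t : ℝ => Complex.exp (Complex.I * t * x)) (Complex.I * x) 0 := by
    have h1 : HasDerivAt (fun t : ℝ => (t : ℂ)) 1 0 := Complex.ofRealCLM.hasDerivAt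
    have h2 := ((h1.const_mul Complex.I).mul_const (x : ℂ)).cexp
    simpa using h2
  have h2 := (hasDerivAt_iff_tendsto_slope_zero.1 h).comp hτ
  refine h2.congr fun n => ?_
  simp only [Function.comp_apply, zero_add, Complex.ofReal_zero, mul_zero, zero_mul,
    Complex.exp_zero, Complex.real_smul, Complex.ofReal_inv]
  rw [div_eq_inv_mul]

namespace LinearPMap

variable {E : Type*} [NormedAddCommGroup E] [InnerProductSpace ℂ E] [CompleteSpace E]
  {A : E →ₗ.[ℂ] E}

theorem unitaryGroup_zero : A.unitaryGroup 0 = 1 := by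
  rw [unitaryGroup, fc, ← A.spectralMeasure.integral_one]
  simp

theorem norm_unitaryGroup_le (t : ℝ) (φ : E) : ‖A.unitaryGroup t φ‖ ≤ ‖φ‖ := by
  have h := A.spectralMeasure.norm_integral_le (bddMeas_exp t).measurable (C := 1)
    (fun x => (norm_exp_I_mul t x).le) φ
  rwa [one_mul] at h

theorem unitaryGroup_mul_neg (t : ℝ) (φ : E) : A.unitaryGroup t (A.unitaryGroup (-t) φ) = φ := by
  rw [unitaryGroup, unitaryGroup, fc, fc,
    A.spectralMeasure.integral_apply_integral (bddMeas_exp t) (bddMeas_exp (-t))]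
  have : (fun x : ℝ => Complex.exp (Complex.I * t * x) *
      Complex.exp (Complex.I * (-t : ℝ) * x)) = fun _ => 1 := by
    ext x
    rw [← Complex.exp_add]
    simp
  rw [this, A.spectralMeasure.integral_one, one_apply_eq_self]

theorem adjoint_unitaryGroup (t : ℝ) :
    ContinuousLinearMap.adjoint (A.unitaryGroup t) = A.unitaryGroup (-t) := by
  rw [unitaryGroup, unitaryGroup, fc, fc, ← A.spectralMeasure.integral_conj (bddMeas_exp t)]
  congr 1
  ext x
  rw [← Complex.exp_conj]
  simp

theorem unitaryGroup_sub_one (t : ℝ) (φ : E) : A.unitaryGroup t φ - φ =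
    A.spectralMeasure.integral (fun x => Complex.exp (Complex.I * t * x) - 1) φ := by
  rw [A.spectralMeasure.integral_sub (bddMeas_exp t) (BddMeas.const 1),
    A.spectralMeasure.integral_one]
  rfl

theorem norm_unitaryGroup_sub_le (hA : IsSelfAdjoint A) {φ : E} (hφ : φ ∈ A.domain) :
    ∃ C, ∀ t, ‖A.unitaryGroup t φ - φ‖ ≤ C * |t| := by
  have hi := ((isSpectralMeasure_spectralMeasure hA).mem_domain_iff φ).1 hφ
  refine ⟨Real.sqrt (∫ x, x ^ 2 ∂(A.spectralMeasure.measure φ)), fun t => ?_⟩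
  refine le_of_sq_le_sq ?_ (by positivity)
  rw [unitaryGroup_sub_one,
    A.spectralMeasure.norm_integral_sq ((bddMeas_exp t).sub (BddMeas.const 1)), mul_pow,
    Real.sq_sqrt (integral_nonneg fun x => by positivity), sq_abs, ← integral_mul_const]
  refine integral_mono_of_nonneg (ae_of_all _ fun x => by positivity) (hi.mul_const _)
    (ae_of_all _ fun x => ?_)
  have := pow_le_pow_left₀ (norm_nonneg _) (norm_exp_sub_one_le t x) 2
  rw [mul_pow, sq_abs, sq_abs] at this
  exact this.trans_eq (mul_comm _ _)

/-- Fatou's lemma: `|(e^{itx} - 1)/t|²` tends to `x²` while its integrals stay below `C²`. -/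
theorem mem_domain_of_norm_unitaryGroup_sub_le (hA : IsSelfAdjoint A) {ψ : E} {C : ℝ}
    (h : ∀ᶠ t in 𝓝 0, ‖A.unitaryGroup t ψ - ψ‖ ≤ C * |t|) : ψ ∈ A.domain := by
  rw [(isSpectralMeasure_spectralMeasure hA).mem_domain_iff]
  set μ := A.spectralMeasure.measure ψ
  have hb : ∀ t : ℝ, BddMeas fun x : ℝ => Complex.exp (Complex.I * t * x) - 1 := fun t =>
    (bddMeas_exp t).sub (BddMeas.const 1)
  let F : ℕ → ℝ → ENNReal := fun n x =>
    ENNReal.ofReal (‖(Complex.exp (Complex.I * smallTime n * x) - 1) / smallTime n‖ ^ 2)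
  have hF : ∀ n, Measurable (F n) := fun n =>
    (((hb (smallTime n)).measurable.div_const _).norm.pow_const 2).ennreal_ofReal
  have hlim : ∀ x : ℝ, liminf (fun n => F n x) atTop = ENNReal.ofReal (x ^ 2) := by
    intro x
    refine Tendsto.liminf_eq ?_
    have := (ENNReal.continuous_ofReal.tendsto _).comp
      ((tendsto_exp_sub_one_div tendsto_smallTime x).norm.pow 2)
    rwa [norm_mul, Complex.norm_I, one_mul, Complex.norm_real, Real.norm_eq_abs, sq_abs] at this
  have hint : ∀ᶠ n in atTop, ∫⁻ x, F n x ∂μ ≤ ENNReal.ofReal (C ^ 2) := by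
    have hev := (tendsto_nhds_of_tendsto_nhdsWithin tendsto_smallTime).eventually h
    filter_upwards [hev] with n hn
    have hp := smallTime_pos n
    have hbn : BddMeas fun x : ℝ =>
        (Complex.exp (Complex.I * smallTime n * x) - 1) / smallTime n := by
      simpa [div_eq_inv_mul] using (hb (smallTime n)).const_mul ((smallTime n : ℂ)⁻¹)
    have hi : Integrable (fun x : ℝ =>
        ‖(Complex.exp (Complex.I * smallTime n * x) - 1) / smallTime n‖ ^ 2) μ := by
      obtain ⟨D, hD⟩ := hbn.bounded
      refine Integrable.of_bound (hbn.measurable.norm.pow_const 2).aestronglyMeasurable (D ^ 2)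
        (ae_of_all _ fun x => ?_)
      rw [Real.norm_of_nonneg (by positivity)]
      exact pow_le_pow_left₀ (norm_nonneg _) (hD x) 2
    rw [← ofReal_integral_eq_lintegral_ofReal hi (ae_of_all _ fun x => by positivity)]
    refine ENNReal.ofReal_le_ofReal ?_
    simp only [norm_div, div_pow, Complex.norm_real, Real.norm_eq_abs, sq_abs]
    rw [integral_div, ← A.spectralMeasure.norm_integral_sq (hb _), ← unitaryGroup_sub_one,
      div_le_iff₀ (by positivity), ← sq_abs (smallTime n), ← mul_pow]
    exact pow_le_pow_left₀ (norm_nonneg _) hn 2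
  have hfin : ∫⁻ x, ENNReal.ofReal (x ^ 2) ∂μ < ⊤ := by
    simp_rw [← hlim]
    refine (lintegral_liminf_le hF).trans_lt (lt_of_le_of_lt ?_ (ENNReal.ofReal_lt_top (r := C ^ 2)))
    exact liminf_le_of_frequently_le' hint.frequently
  refine ⟨(measurable_id.pow_const 2).aestronglyMeasurable, ?_⟩
  rw [hasFiniteIntegral_iff_ofReal (ae_of_all _ fun x => by positivity)]
  exact hfin

/-- A bounded operator of class `C¹(A)` leaves the domain of `A` invariant. -/
theorem IsClassC.apply_mem_domain (hA : IsSelfAdjoint A) {S : E →L[ℂ] E} (hS : A.IsClassC 1 S)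
    {φ : E} (hφ : φ ∈ A.domain) : S φ ∈ A.domain := by
  have hd : DifferentiableAt ℝ (fun t : ℝ => A.unitaryGroup (-t) (S (A.unitaryGroup t φ))) 0 :=
    ((hS φ).differentiable one_ne_zero).differentiableAt
  obtain ⟨C, hC⟩ := hd.isBigO_sub.bound
  obtain ⟨D, hD⟩ := norm_unitaryGroup_sub_le hA hφ
  refine mem_domain_of_norm_unitaryGroup_sub_le hA (C := C + ‖S‖ * D) ?_
  have hneg : Tendsto (fun t : ℝ => -t) (𝓝 0) (𝓝 0) := by
    simpa using (continuous_neg (G := ℝ)).tendsto 0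
  filter_upwards [hneg.eventually hC] with t ht
  simp only [neg_neg, neg_zero, unitaryGroup_zero, one_apply_eq_self, sub_zero, norm_neg,
    Real.norm_eq_abs] at ht
  -- The first term is `O(t)` by differentiability of the conjugated operator, taken at time `-t`;
  -- the second because `φ` is in the domain of `A`.
  have e : A.unitaryGroup t (S φ) - S φ = (A.unitaryGroup t (S (A.unitaryGroup (-t) φ)) - S φ) -
      A.unitaryGroup t (S (A.unitaryGroup (-t) φ - φ)) := by
    rw [_root_.map_sub, _root_.map_sub]
    abel
  rw [e, add_mul]
  refine (norm_sub_le _ _).trans (add_le_add ht ?_)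
  refine (norm_unitaryGroup_le _ _).trans ((S.le_opNorm _).trans ?_)
  rw [mul_assoc]
  gcongr
  simpa using hD (-t)

/-- The difference quotients of the group converge weakly on the domain of the generator. -/
theorem tendsto_inner_unitaryGroup (hA : IsSelfAdjoint A) {v a : E} (hv : (v, a) ∈ A.graph)
    {τ : ℕ → ℝ}
    (hτ : Tendsto τ atTop (𝓝[≠] 0)) (hτ0 : ∀ n, τ n ≠ 0) (w : E) :
    Tendsto (fun n => inner ℂ w ((τ n : ℂ)⁻¹ • (A.unitaryGroup (τ n) v - v))) atTop
      (𝓝 (inner ℂ w (Complex.I • a))) := by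
  set P := A.spectralMeasure with hP
  have hr := resolventFun_bddMeas
  have hb : ∀ t : ℝ, BddMeas fun x : ℝ => Complex.exp (Complex.I * t * x) - 1 := fun t =>
    (bddMeas_exp t).sub (BddMeas.const 1)
  set η := a - Complex.I • v with hη
  have hPr := spectralMeasure_integral_resolventFun hA
  -- Writing `v = (A - i)⁻¹ η` inserts the factor `(x - i)⁻¹`, which makes the difference quotients
  -- bounded by 1 uniformly in time and allows dominated convergence.
  have hvη : v = P.integral resolventFun η := by
    rw [hPr, resolventAt_sub hA I_im_ne_zero hv]
  have haη : a = P.integral (fun x => (x : ℂ) * resolventFun x) η := by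
    simp_rw [ofReal_mul_resolventFun]
    rw [P.integral_add (BddMeas.const 1) (hr.const_mul _), P.integral_const_mul _ hr,
      P.integral_one]
    change a = η + Complex.I • P.integral resolventFun η
    rw [← hvη, hη, sub_add_cancel]
  have hF : ∀ n, BddMeas fun x : ℝ => (τ n : ℂ)⁻¹ *
      ((Complex.exp (Complex.I * τ n * x) - 1) * resolventFun x) := fun n =>
    ((hb _).mul hr).const_mul _
  have hle : ∀ x : ℝ, |x| * ‖resolventFun x‖ ≤ 1 := by
    intro x
    refine le_of_sq_le_sq ?_ zero_le_one
    rw [mul_pow, norm_resolventFun_sq, sq_abs, one_pow, mul_inv_le_iff₀ (by positivity)]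
    linarith
  have h := P.tendsto_inner_integral (f := fun x => Complex.I * ((x : ℂ) * resolventFun x))
    (C := 1) hF (fun n x => ?_) (fun x => ?_) w η
  · have e1 : P.integral (fun x => Complex.I * ((x : ℂ) * resolventFun x)) η = Complex.I • a := by
      rw [haη, P.integral_const_mul]
      · rfl
      · simp_rw [ofReal_mul_resolventFun]
        exact (BddMeas.const 1).add (hr.const_mul _)
    rw [e1] at h
    refine h.congr fun n => ?_
    rw [P.integral_const_mul _ ((hb _).mul hr), _root_.smul_apply, ← P.integral_apply_integral (hb _) hr,
      ← hvη, unitaryGroup_sub_one]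
  · have hp := hτ0 n
    rw [norm_mul, norm_mul, norm_inv, Complex.norm_real, Real.norm_eq_abs]
    calc |τ n|⁻¹ * (‖Complex.exp (Complex.I * τ n * x) - 1‖ * ‖resolventFun x‖)
        ≤ |τ n|⁻¹ * ((|τ n| * |x|) * ‖resolventFun x‖) := by
          gcongr
          exact norm_exp_sub_one_le _ _
      _ = |x| * ‖resolventFun x‖ := by
          have := abs_pos.2 hp
          field_simp
      _ ≤ 1 := hle x
  · have := (tendsto_exp_sub_one_div hτ x).mul_const (resolventFun x)
    rw [mul_assoc] at this
    refine this.congr fun n => ?_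
    rw [div_eq_inv_mul, mul_assoc]

/-- The derivative at `0` of `t ↦ e^{-itA} S e^{itA}`, for `S` of class `C¹(A)`. -/
theorem IsClassC.exists_derivative {S : E →L[ℂ] E} (hS : A.IsClassC 1 S) :
    ∃ D : E →L[ℂ] E, ∀ φ, Tendsto (fun n => (smallTime n : ℂ)⁻¹ •
      (A.unitaryGroup (-smallTime n) (S (A.unitaryGroup (smallTime n) φ)) - S φ)) atTop
        (𝓝 (D φ)) := by
  have h : ∀ φ, ∃ d, Tendsto (fun n => (smallTime n : ℂ)⁻¹ •
      (A.unitaryGroup (-smallTime n) (S (A.unitaryGroup (smallTime n) φ)) - S φ)) atTop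
        (𝓝 d) := by
    intro φ
    have hd : DifferentiableAt ℝ (fun t : ℝ => A.unitaryGroup (-t) (S (A.unitaryGroup t φ))) 0 :=
      ((hS φ).differentiable one_ne_zero).differentiableAt
    have h2 := (hasDerivAt_iff_tendsto_slope_zero.1 hd.hasDerivAt).comp tendsto_smallTime
    refine ⟨_, h2.congr fun n => ?_⟩
    simp only [Function.comp_apply, zero_add, neg_zero, unitaryGroup_zero, one_apply_eq_self]
    rw [← Complex.ofReal_inv, Complex.coe_smul]
  choose d hd using h
  let G : ℕ → E →L[ℂ] E := fun n => (smallTime n : ℂ)⁻¹ •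
    (A.unitaryGroup (-smallTime n) * S * A.unitaryGroup (smallTime n) - S)
  -- Boundedness of the pointwise limit is the Banach–Steinhaus theorem.
  exact ⟨continuousLinearMapOfTendsto G (tendsto_pi_nhds.2 hd), hd⟩

/-- If `(H - i)⁻¹` is of class `C¹(A)`, then the commutator form has a continuous extension. -/
theorem exists_extendsCommutator {H : E →ₗ.[ℂ] E} (hH : IsSelfAdjoint H) (hA : IsSelfAdjoint A)
    (hC1 : A.IsClassC 1 (H.resolventAt Complex.I)) : ∃ F, ExtendsCommutator H A F := by
  obtain ⟨D, hD⟩ := hC1.exists_derivative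
  set R := H.resolventAt Complex.I with hR
  -- Formally `D = -i R [H, A] R` and `V (H - i) u = (H + i) u`, so that `⟨V (H - i) u, i D (H - i)
  -- v⟩ = ⟨u, [H, A] v⟩`. The left side is continuous in the graph norms.
  let V : E →L[ℂ] E := 1 + (2 * Complex.I) • R
  let β : E →L⋆[ℂ] E →L[ℂ] ℂ := (innerSL ℂ).bilinearComp V (Complex.I • D)
  refine ⟨β.bilinearComp (H.subScalar Complex.I) (H.subScalar Complex.I),
    fun u v hu hv => ?_⟩
  change inner ℂ (V (H u - Complex.I • (u : E))) ((Complex.I • D) (H v - Complex.I • (v : E))) = _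
  set η := H u - Complex.I • (u : E) with hη
  set ζ := H v - Complex.I • (v : E) with hζ
  have hu1 : R η = u := resolventAt_sub hH I_im_ne_zero (H.mem_graph u)
  have hv1 : R ζ = v := resolventAt_sub hH I_im_ne_zero (H.mem_graph v)
  have hHu : H u = η + Complex.I • (u : E) := by rw [hη, sub_add_cancel]
  have hHv : H v = ζ + Complex.I • (v : E) := by rw [hζ, sub_add_cancel]
  have hVη : V η = η + (2 * Complex.I) • (u : E) := by
    rw [← hu1]
    rfl
  let Q : ℕ → E → E := fun n x => (smallTime n : ℂ)⁻¹ • (A.unitaryGroup (smallTime n) x - x)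
  let d : ℕ → E := fun n => (smallTime n : ℂ)⁻¹ •
    (A.unitaryGroup (-smallTime n) (R (A.unitaryGroup (smallTime n) ζ)) - R ζ)
  have hd : Tendsto d atTop (𝓝 (D ζ)) := hD ζ
  have hneg : Tendsto (fun n => -smallTime n) atTop (𝓝[≠] 0) := by
    refine tendsto_nhdsWithin_of_tendsto_nhds_of_eventually_within _ ?_
      (Eventually.of_forall fun n => (neg_ne_zero.2 (smallTime_pos n).ne'))
    simpa using (tendsto_nhds_of_tendsto_nhdsWithin tendsto_smallTime).neg
  have h1 := tendsto_inner_unitaryGroup hA (A.mem_graph ⟨v, hv⟩) tendsto_smallTime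
    (fun n => (smallTime_pos n).ne') (H u)
  have h2 := tendsto_inner_unitaryGroup hA (A.mem_graph ⟨u, hu⟩) hneg
    (fun n => neg_ne_zero.2 (smallTime_pos n).ne') (H v)
  have h3 : Tendsto (fun n => inner ℂ (V η) (A.unitaryGroup (smallTime n) (d n))) atTop
      (𝓝 (inner ℂ (V η) (D ζ))) := by
    have e1 : Tendsto (fun n => inner ℂ (V η) (A.unitaryGroup (smallTime n) (D ζ))) atTop
        (𝓝 (inner ℂ (V η) (D ζ))) := by
      have := A.spectralMeasure.tendsto_inner_integral (f := fun _ => 1) (C := 1)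
        (fun n => bddMeas_exp (smallTime n)) (fun n x => ?_) (fun x => ?_) (V η) (D ζ)
      · rwa [A.spectralMeasure.integral_one, one_apply_eq_self] at this
      · exact (norm_exp_I_mul (smallTime n) x).le
      · have hc : Continuous fun t : ℝ => Complex.exp (Complex.I * t * x) := by fun_prop
        have := (hc.tendsto 0).comp (tendsto_nhds_of_tendsto_nhdsWithin tendsto_smallTime)
        simpa [Function.comp_def] using this
    have e2 : Tendsto (fun n => inner ℂ (V η) (A.unitaryGroup (smallTime n) (d n - D ζ))) atTop
        (𝓝 0) := by
      have h0 := (tendsto_iff_norm_sub_tendsto_zero.1 hd).const_mul ‖V η‖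
      rw [mul_zero] at h0
      refine squeeze_zero_norm (fun n => ?_) h0
      refine (norm_inner_le_norm _ _).trans ?_
      gcongr
      exact norm_unitaryGroup_le _ _
    have := e2.add e1
    rw [zero_add] at this
    refine this.congr fun n => ?_
    rw [← inner_add_right, ← _root_.map_add, sub_add_cancel]
  -- An exact identity at positive time, resting on `⟨u, x⟩ = ⟨V η, R x⟩`. As `H v` need not lie in
  -- the domain of `A`, the group is moved from `H v` to `u`, which reverses time; both quotients
  -- then act on vectors of that domain and converge weakly.
  have key : ∀ n, -inner ℂ (V η) (A.unitaryGroup (smallTime n) (d n)) = inner ℂ (H u) (Q n v) -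
      starRingEnd ℂ (inner ℂ (H v) (((-smallTime n : ℝ) : ℂ)⁻¹ •
        (A.unitaryGroup (-smallTime n) (u : E) - u))) * (-1) := by
    intro n
    have e1 : A.unitaryGroup (smallTime n) (d n) = R (Q n ζ) - Q n v := by
      simp only [d, Q, _root_.map_smul, _root_.map_sub, unitaryGroup_mul_neg, hv1]
      module
    have e2 : inner ℂ (u : E) (Q n (H v)) = starRingEnd ℂ (inner ℂ (H v)
        (((-smallTime n : ℝ) : ℂ)⁻¹ • (A.unitaryGroup (-smallTime n) (u : E) - u))) * (-1) := by
      rw [inner_conj_symm, inner_smul_left, inner_smul_right, inner_sub_left, inner_sub_right,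
        ← adjoint_unitaryGroup, ContinuousLinearMap.adjoint_inner_left, Complex.ofReal_neg,
        inv_neg, _root_.map_neg, ← Complex.ofReal_inv, Complex.conj_ofReal]
      ring
    have e3 : Q n (H v) = Q n ζ + Complex.I • Q n v := by
      simp only [Q, hHv, _root_.map_add, _root_.map_smul]
      module
    have e4 := inner_resolventAt_I hH η (Q n ζ)
    rw [← hR, hu1] at e4
    rw [← e2, e1, e3, hHu, hVη]
    simp only [inner_add_left, inner_add_right, inner_sub_right, inner_smul_left,
      inner_smul_right, _root_.map_mul, Complex.conj_I, Complex.conj_ofNat]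
    linear_combination e4
  have hlim := (h1.sub ((Complex.continuous_conj.tendsto _).comp h2 |>.mul_const (-1))).congr
    fun n => (key n).symm
  have hfin := tendsto_nhds_unique h3.neg hlim
  simp only [inner_smul_right, _root_.map_mul, Complex.conj_I, inner_conj_symm] at hfin
  rw [_root_.smul_apply, inner_smul_right]
  linear_combination (-Complex.I) * hfin -
    (inner ℂ (H u) (A ⟨v, hv⟩) - inner ℂ (A ⟨u, hu⟩) (H v)) * Complex.I_sq

end LinearPMap

end

/-! ### The Cayley function, trigonometric approximation and primitives for the Cauchy measure. -/

noncomputable section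

set_option linter.unusedSectionVars false

open Filter Topology

/-- The Cayley function `x ↦ (x + i) / (x - i)`, written as `1 + 2i (x - i)⁻¹`. -/
def cayleyFun (x : ℝ) : ℂ := 1 + 2 * Complex.I * resolventFun x

theorem cayleyFun_eq_div (x : ℝ) : cayleyFun x = ((x : ℂ) + Complex.I) / ((x : ℂ) - Complex.I) := by
  have := ofReal_sub_I_ne_zero x
  rw [cayleyFun, resolventFun]
  field_simp
  ring

theorem conj_cayleyFun_mul (x : ℝ) : starRingEnd ℂ (cayleyFun x) * cayleyFun x = 1 := by
  have h := ofReal_sub_I_ne_zero x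
  have h' : (x : ℂ) + Complex.I ≠ 0 := fun h => by simpa using congrArg Complex.im h
  rw [cayleyFun_eq_div]
  simp only [map_div₀, map_add, map_sub, Complex.conj_ofReal, Complex.conj_I, sub_neg_eq_add,
    ← sub_eq_add_neg]
  field_simp

theorem cayleyFun_ne_zero (x : ℝ) : cayleyFun x ≠ 0 := by
  intro h
  simpa [h] using conj_cayleyFun_mul x

theorem cayleyFun_inv (x : ℝ) : (cayleyFun x)⁻¹ = starRingEnd ℂ (cayleyFun x) :=
  (eq_inv_of_mul_eq_one_left (conj_cayleyFun_mul x)).symm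

theorem norm_cayleyFun (x : ℝ) : ‖cayleyFun x‖ = 1 := by
  have h := congrArg norm (conj_cayleyFun_mul x)
  rw [norm_mul, RCLike.norm_conj, norm_one] at h
  nlinarith [norm_nonneg (cayleyFun x)]

theorem continuous_resolventFun : Continuous resolventFun := by
  unfold resolventFun
  exact Continuous.inv₀ (by fun_prop) ofReal_sub_I_ne_zero

theorem cayleyFun_bddMeas : BddMeas cayleyFun :=
  (BddMeas.const 1).add (resolventFun_bddMeas.const_mul _)

theorem norm_cayleyFun_zpow (n : ℤ) (x : ℝ) : ‖cayleyFun x ^ n‖ = 1 := by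
  rw [norm_zpow, norm_cayleyFun, one_zpow]

theorem continuous_cayleyFun_zpow (n : ℤ) : Continuous fun x => cayleyFun x ^ n :=
  (continuous_const.add (continuous_const.mul continuous_resolventFun)).zpow₀ n
    fun x => Or.inl (cayleyFun_ne_zero x)

theorem cayleyFun_zpow_bddMeas (n : ℤ) : BddMeas fun x => cayleyFun x ^ n :=
  ⟨(continuous_cayleyFun_zpow n).measurable, 1, fun x => (norm_cayleyFun_zpow n x).le⟩

theorem cayleyFun_injective : Function.Injective cayleyFun := by
  intro x y h
  have h1 : resolventFun x = resolventFun y := by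
    have := add_left_cancel h
    exact mul_left_cancel₀ (by simp) this
  have h2 : (x : ℂ) - Complex.I = (y : ℂ) - Complex.I := inv_injective h1
  exact_mod_cast sub_left_injective h2

theorem hasDerivAt_cayleyFun_zpow (n : ℤ) (x : ℝ) :
    HasDerivAt (fun x => cayleyFun x ^ n)
      (-2 * Complex.I * n * (((1 + x ^ 2)⁻¹ : ℝ) • cayleyFun x ^ n)) x := by
  have h0 := ofReal_sub_I_ne_zero x
  have h0' : (x : ℂ) + Complex.I ≠ 0 := fun h => by simpa using congrArg Complex.im h
  have h1 : HasDerivAt (fun t : ℝ => (t : ℂ)) 1 x := Complex.ofRealCLM.hasDerivAt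
  have h2 : HasDerivAt cayleyFun (2 * Complex.I * (-1 / ((x : ℂ) - Complex.I) ^ 2)) x :=
    (((h1.sub_const Complex.I).inv h0).const_mul (2 * Complex.I)).const_add 1
  have h3 := (hasDerivAt_zpow n (cayleyFun x) (Or.inl (cayleyFun_ne_zero x))).comp x h2
  refine h3.congr_deriv ?_
  have h4 : (((1 + x ^ 2)⁻¹ : ℝ) : ℂ) = (((x : ℂ) + Complex.I) * ((x : ℂ) - Complex.I))⁻¹ := by
    push_cast
    congr 1
    linear_combination Complex.I_sq
  rw [Complex.real_smul, h4, zpow_sub_one₀ (cayleyFun_ne_zero x)]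
  have h5 : (cayleyFun x)⁻¹ = ((x : ℂ) - Complex.I) / ((x : ℂ) + Complex.I) := by
    rw [cayleyFun_eq_div, inv_div]
  rw [h5]
  field_simp

/-- The common limit at both ends closes the line up to a circle. It makes the nonconstant powers
have mean zero and fixes the constant in their primitives. -/
theorem tendsto_cayleyFun_zpow (n : ℤ) {l : Filter ℝ} (hl : Tendsto (fun x : ℝ => |x|) l atTop) :
    Tendsto (fun x => cayleyFun x ^ n) l (𝓝 1) := by
  have h1 : Tendsto resolventFun l (𝓝 0) := by
    have h : Tendsto (fun x : ℝ => (|x|)⁻¹) l (𝓝 0) := tendsto_inv_atTop_zero.comp hl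
    refine squeeze_zero_norm' ?_ h
    filter_upwards [hl.eventually_gt_atTop 0] with x hx
    rw [resolventFun, norm_inv]
    refine inv_anti₀ hx ?_
    have := Complex.abs_re_le_norm ((x : ℂ) - Complex.I)
    simpa using this
  have h2 : Tendsto cayleyFun l (𝓝 1) := by
    have := (h1.const_mul (2 * Complex.I)).const_add 1
    rw [mul_zero, add_zero] at this
    exact this
  have := h2.zpow₀ n (Or.inl one_ne_zero)
  rwa [one_zpow] at this

/-- The coordinate `1/2 - arctan(x)/π` in which the Cayley function becomes the first character of
the circle. -/
def circleCoord (x : ℝ) : UnitAddCircle := ((1 / 2 - Real.arctan x / Real.pi : ℝ) : UnitAddCircle)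

theorem continuous_circleCoord : Continuous circleCoord :=
  (AddCircle.continuous_mk' 1).comp
    (continuous_const.sub (Real.continuous_arctan.div_const _))

theorem fourier_circleCoord (n : ℤ) (x : ℝ) : fourier n (circleCoord x) = cayleyFun x ^ n := by
  have hπ : (Real.pi : ℂ) ≠ 0 := by exact_mod_cast Real.pi_ne_zero
  have e1 : Complex.exp (Real.arctan x * Complex.I) =
      (1 + x * Complex.I) / (Real.sqrt (1 + x ^ 2) : ℂ) := by
    rw [Complex.exp_mul_I, ← Complex.ofReal_cos, ← Complex.ofReal_sin, Real.cos_arctan,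
      Real.sin_arctan]
    push_cast
    ring
  have hs : (Real.sqrt (1 + x ^ 2) : ℂ) ^ 2 = (1 + x * Complex.I) * (1 - x * Complex.I) := by
    rw [← Complex.ofReal_pow, Real.sq_sqrt (by positivity)]
    push_cast
    linear_combination (x : ℂ) ^ 2 * Complex.I_sq
  have h1 : (1 + x * Complex.I : ℂ) ≠ 0 := fun h => by simpa using congrArg Complex.re h
  have h2 : (1 - x * Complex.I : ℂ) ≠ 0 := fun h => by simpa using congrArg Complex.re h
  have e2 : Complex.exp (2 * (Real.arctan x * Complex.I)) =
      (1 + x * Complex.I) / (1 - x * Complex.I) := by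
    rw [two_mul, Complex.exp_add, e1, ← sq, div_pow, hs]
    field_simp
  rw [circleCoord, fourier_coe_apply]
  have e3 : 2 * Real.pi * Complex.I * n * ((1 / 2 - Real.arctan x / Real.pi : ℝ) : ℂ) / ((1 : ℝ) : ℂ)
      = n * (Real.pi * Complex.I - 2 * (Real.arctan x * Complex.I)) := by
    push_cast
    field_simp
  rw [e3, Complex.exp_int_mul, Complex.exp_sub, e2, Complex.exp_pi_mul_I, cayleyFun_eq_div]
  congr 1
  have := ofReal_sub_I_ne_zero x
  field_simp
  linear_combination (-2 * (x : ℂ)) * Complex.I_sq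

theorem circleCoord_injective : Function.Injective circleCoord := by
  intro x y h
  refine cayleyFun_injective ?_
  have := congrArg (fourier 1) h
  simpa only [fourier_circleCoord, zpow_one] using this

/-- Induction principle for bounded measurable functions on the real line, starting from the powers
of the Cayley function. -/
theorem BddMeas.induction_cayleyFun {p : (ℝ → ℂ) → Prop}
    (zpow : ∀ n : ℤ, p fun x => cayleyFun x ^ n)
    (add : ∀ f g, BddMeas f → BddMeas g → p f → p g → p fun x => f x + g x)
    (smul : ∀ (c : ℂ) f, BddMeas f → p f → p fun x => c * f x)
    (lim : ∀ (F : ℕ → ℝ → ℂ) (f : ℝ → ℂ) (C : ℝ), (∀ n, BddMeas (F n)) → (∀ n x, ‖F n x‖ ≤ C) →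
      (∀ x, Tendsto (fun n => F n x) atTop (𝓝 (f x))) → (∀ n, p (F n)) → p f)
    {f : ℝ → ℂ} (hf : BddMeas f) : p f := by
  have hm : Measurable circleCoord := continuous_circleCoord.measurable
  have hb : ∀ K : C(UnitAddCircle, ℂ), BddMeas K := fun K => K.bddMeas
  have hspan : ∀ K ∈ Submodule.span ℂ (Set.range (fourier (T := (1 : ℝ)))),
      p fun x => K (circleCoord x) := by
    intro K hK
    induction hK using Submodule.span_induction with
    | mem K hK =>
      obtain ⟨n, rfl⟩ := hK
      simp_rw [fourier_circleCoord]
      exact zpow n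
    | zero => simpa using smul 0 _ (cayleyFun_zpow_bddMeas 0) (zpow 0)
    | add K L _ _ hK hL => exact add _ _ ((hb K).comp hm) ((hb L).comp hm) hK hL
    | smul c K _ hK => exact smul c _ ((hb K).comp hm) hK
  have hcont : ∀ K : C(UnitAddCircle, ℂ), p fun x => K (circleCoord x) := by
    intro K
    -- Density of trigonometric polynomials; their uniform limits are in particular bounded
    -- pointwise limits.
    have hK : K ∈ closure (Submodule.span ℂ (Set.range (fourier (T := (1 : ℝ)))) :
        Set C(UnitAddCircle, ℂ)) := by
      rw [← Submodule.topologicalClosure_coe, span_fourier_closure_eq_top]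
      trivial
    obtain ⟨L, hL, hlim⟩ := mem_closure_iff_seq_limit.1 hK
    obtain ⟨C, hC⟩ := hlim.norm.bddAbove_range
    refine lim (fun n x => L n (circleCoord x)) _ C (fun n => (hb (L n)).comp hm)
      (fun n x => ((L n).norm_coe_le_norm _).trans (hC ⟨n, rfl⟩)) (fun x => ?_)
      fun n => hspan _ (hL n)
    exact ((continuous_eval_const (circleCoord x)).tendsto K).comp hlim
  have hall : ∀ K : UnitAddCircle → ℂ, BddMeas K → p fun x => K (circleCoord x) := by
    intro K hK
    refine hK.induction_continuous (p := fun K => p fun x => K (circleCoord x))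
      (fun K hK _ => hcont ⟨K, hK⟩) (fun K L hK hL h1 h2 => add _ _ (hK.comp hm) (hL.comp hm) h1 h2)
      (fun c K hK h => smul c _ (hK.comp hm) h) fun F K C hF hC hlim h => ?_
    exact lim _ _ C (fun n => (hF n).comp hm) (fun n x => hC n _) (fun x => hlim _) h
  have hemb : MeasurableEmbedding circleCoord :=
    continuous_circleCoord.measurableEmbedding circleCoord_injective
  obtain ⟨C, hC⟩ := hf.bounded
  -- The line sits in the circle as a Borel subset, so `f` extended by zero is Borel on the circle
  -- and restricts back to `f`.
  have hK : BddMeas (Function.extend circleCoord f 0) := by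
    refine ⟨hemb.measurable_extend hf.measurable measurable_zero, C, fun z => ?_⟩
    by_cases hz : ∃ x, circleCoord x = z
    · obtain ⟨x, rfl⟩ := hz
      rw [circleCoord_injective.extend_apply]
      exact hC x
    · rw [Function.extend_apply' _ _ _ hz]
      simpa using (norm_nonneg _).trans (hC 0)
  have := hall _ hK
  simpa only [circleCoord_injective.extend_apply] using this

/-- The Cauchy measure `dx / (1 + x²)`. -/
def cauchyMeasure : Measure ℝ := volume.withDensity fun x => ENNReal.ofReal (1 + x ^ 2)⁻¹

instance : IsFiniteMeasure cauchyMeasure :=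
  isFiniteMeasure_withDensity_ofReal integrable_inv_one_add_sq.2

theorem setIntegral_cauchyMeasure {s : Set ℝ} (hs : MeasurableSet s) (f : ℝ → ℂ) :
    ∫ x in s, f x ∂cauchyMeasure = ∫ x in s, (1 + x ^ 2)⁻¹ • f x := by
  rw [cauchyMeasure, setIntegral_withDensity_eq_setIntegral_toReal_smul (by fun_prop)
    (ae_of_all _ fun x => ENNReal.ofReal_lt_top) _ hs]
  congr 1
  ext x
  rw [ENNReal.toReal_ofReal (by positivity)]

theorem cauchyMeasure_univ : cauchyMeasure.real Set.univ = Real.pi := by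
  have h : ((cauchyMeasure.real Set.univ : ℝ) : ℂ) = (Real.pi : ℂ) := by
    have h1 := setIntegral_cauchyMeasure MeasurableSet.univ (fun _ => 1)
    rw [Measure.restrict_univ, setIntegral_univ, integral_const] at h1
    have h2 : (fun x : ℝ => (1 + x ^ 2)⁻¹ • (1 : ℂ)) = fun x => (((1 + x ^ 2)⁻¹ : ℝ) : ℂ) := by
      ext x
      simp
    rw [h2, integral_complex_ofReal, integral_univ_inv_one_add_sq] at h1
    simpa using h1
  exact_mod_cast h

/-- The mean of a function with respect to the normalized Cauchy measure. -/
def cauchyMean (k : ℝ → ℂ) : ℂ := (Real.pi : ℂ)⁻¹ * ∫ x, k x ∂cauchyMeasure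

/-- The primitive of `k - cauchyMean k` with respect to the Cauchy measure. -/
def cauchyPrimitive (k : ℝ → ℂ) (t : ℝ) : ℂ := ∫ x in Set.Iic t, (k x - cauchyMean k) ∂cauchyMeasure

theorem cauchyMean_one : cauchyMean (fun _ => 1) = 1 := by
  have : (Real.pi : ℂ) ≠ 0 := by exact_mod_cast Real.pi_ne_zero
  rw [cauchyMean, integral_const, cauchyMeasure_univ]
  simp [this]

theorem cauchyMean_add {f g : ℝ → ℂ} (hf : BddMeas f) (hg : BddMeas g) :
    cauchyMean (fun x => f x + g x) = cauchyMean f + cauchyMean g := by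
  rw [cauchyMean, integral_add (hf.integrable _) (hg.integrable _), mul_add]
  rfl

theorem cauchyMean_const_mul (c : ℂ) (f : ℝ → ℂ) :
    cauchyMean (fun x => c * f x) = c * cauchyMean f := by
  rw [cauchyMean, integral_const_mul, cauchyMean]
  ring

theorem norm_cauchyMean_le {f : ℝ → ℂ} {C : ℝ} (hC : ∀ x, ‖f x‖ ≤ C) : ‖cauchyMean f‖ ≤ C := by
  have h := norm_integral_le_of_norm_le_const (μ := cauchyMeasure) (ae_of_all _ hC)
  rw [cauchyMeasure_univ] at h
  rw [cauchyMean, norm_mul, norm_inv, Complex.norm_real, Real.norm_of_nonneg Real.pi_pos.le,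
    inv_mul_le_iff₀ Real.pi_pos]
  linarith

theorem tendsto_cauchyMean {F : ℕ → ℝ → ℂ} {f : ℝ → ℂ} {C : ℝ} (hF : ∀ n, BddMeas (F n))
    (hC : ∀ n x, ‖F n x‖ ≤ C) (hlim : ∀ x, Tendsto (fun n => F n x) atTop (𝓝 (f x))) :
    Tendsto (fun n => cauchyMean (F n)) atTop (𝓝 (cauchyMean f)) :=
  (tendsto_integral_of_dominated_convergence (fun _ => C)
    (fun n => (hF n).measurable.aestronglyMeasurable) (integrable_const C)
    (fun n => ae_of_all _ (hC n)) (ae_of_all _ hlim)).const_mul _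

theorem cauchyPrimitive_add {f g : ℝ → ℂ} (hf : BddMeas f) (hg : BddMeas g) :
    cauchyPrimitive (fun x => f x + g x) = fun t => cauchyPrimitive f t + cauchyPrimitive g t := by
  ext t
  rw [cauchyPrimitive, cauchyMean_add hf hg, cauchyPrimitive, cauchyPrimitive,
    ← integral_add ((hf.sub (BddMeas.const _)).integrable _)
      ((hg.sub (BddMeas.const _)).integrable _)]
  congr 1
  ext x
  ring

theorem cauchyPrimitive_const_mul (c : ℂ) (f : ℝ → ℂ) :
    cauchyPrimitive (fun x => c * f x) = fun t => c * cauchyPrimitive f t := by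
  ext t
  rw [cauchyPrimitive, cauchyMean_const_mul, cauchyPrimitive, ← integral_const_mul]
  simp_rw [mul_sub]

theorem norm_cauchyPrimitive_le {f : ℝ → ℂ} {C : ℝ} (hC : ∀ x, ‖f x‖ ≤ C) (t : ℝ) :
    ‖cauchyPrimitive f t‖ ≤ 2 * C * Real.pi := by
  have h0 : 0 ≤ C := (norm_nonneg _).trans (hC 0)
  have h := norm_integral_le_of_norm_le_const (μ := cauchyMeasure.restrict (Set.Iic t))
    (f := fun x => f x - cauchyMean f) (C := 2 * C) (ae_of_all _ fun x => by
      have := norm_sub_le (f x) (cauchyMean f)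
      linarith [hC x, norm_cauchyMean_le hC])
  refine h.trans ?_
  rw [← cauchyMeasure_univ]
  gcongr
  rw [measureReal_restrict_apply MeasurableSet.univ]
  exact measureReal_mono (Set.subset_univ _)

theorem tendsto_cauchyPrimitive {F : ℕ → ℝ → ℂ} {f : ℝ → ℂ} {C : ℝ} (hF : ∀ n, BddMeas (F n))
    (hC : ∀ n x, ‖F n x‖ ≤ C) (hlim : ∀ x, Tendsto (fun n => F n x) atTop (𝓝 (f x))) (t : ℝ) :
    Tendsto (fun n => cauchyPrimitive (F n) t) atTop (𝓝 (cauchyPrimitive f t)) :=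
  tendsto_integral_of_dominated_convergence (fun _ => 2 * C)
    (fun n => ((hF n).sub (BddMeas.const _)).measurable.aestronglyMeasurable) (integrable_const _)
    (fun n => ae_of_all _ fun x => by
      have := norm_sub_le (F n x) (cauchyMean (F n))
      linarith [hC n x, norm_cauchyMean_le (hC n)])
    (ae_of_all _ fun x => (hlim x).sub (tendsto_cauchyMean hF hC hlim))

theorem integrable_inv_smul_cayleyFun_zpow (n : ℤ) :
    Integrable fun x : ℝ => (1 + x ^ 2)⁻¹ • cayleyFun x ^ n := by
  refine integrable_inv_one_add_sq.mono ?_ (ae_of_all _ fun x => ?_)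
  · exact (Measurable.smul (f := fun x : ℝ => (1 + x ^ 2)⁻¹) (by fun_prop)
      (continuous_cayleyFun_zpow n).measurable).aestronglyMeasurable
  · rw [norm_smul, norm_cayleyFun_zpow, mul_one]

theorem hasDerivAt_primitive_zpow {n : ℤ} (hn : n ≠ 0) (x : ℝ) :
    HasDerivAt (fun x => Complex.I / (2 * n) * cayleyFun x ^ n)
      ((1 + x ^ 2)⁻¹ • cayleyFun x ^ n) x := by
  have hn' : (n : ℂ) ≠ 0 := by exact_mod_cast hn
  refine ((hasDerivAt_cayleyFun_zpow n x).const_mul (Complex.I / (2 * n))).congr_deriv ?_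
  generalize (1 + x ^ 2)⁻¹ • cayleyFun x ^ n = w
  field_simp
  linear_combination (-w) * Complex.I_sq

theorem cauchyMean_zpow {n : ℤ} (hn : n ≠ 0) : cauchyMean (fun x => cayleyFun x ^ n) = 0 := by
  have h := integral_of_hasDerivAt_of_tendsto (hasDerivAt_primitive_zpow hn)
    (integrable_inv_smul_cayleyFun_zpow n)
    ((tendsto_cayleyFun_zpow n tendsto_abs_atBot_atTop).const_mul _)
    ((tendsto_cayleyFun_zpow n tendsto_abs_atTop_atTop).const_mul _)
  have h2 := setIntegral_cauchyMeasure MeasurableSet.univ fun x => cayleyFun x ^ n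
  rw [Measure.restrict_univ, setIntegral_univ, h, sub_self] at h2
  rw [cauchyMean, h2, mul_zero]

theorem cauchyPrimitive_zpow {n : ℤ} (hn : n ≠ 0) :
    cauchyPrimitive (fun x => cayleyFun x ^ n) =
      fun t => Complex.I / (2 * n) * (cayleyFun t ^ n - 1) := by
  ext t
  rw [cauchyPrimitive, cauchyMean_zpow hn]
  simp_rw [sub_zero]
  rw [setIntegral_cauchyMeasure measurableSet_Iic,
    integral_Iic_of_hasDerivAt_of_tendsto' (fun x _ => hasDerivAt_primitive_zpow hn x)
      (integrable_inv_smul_cayleyFun_zpow n).integrableOn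
      ((tendsto_cayleyFun_zpow n tendsto_abs_atBot_atTop).const_mul _)]
  ring

theorem cauchyPrimitive_one : cauchyPrimitive (fun _ => 1) = fun _ => 0 := by
  ext t
  rw [cauchyPrimitive, cauchyMean_one]
  simp

theorem cauchyMean_eq_zero {f : ℝ → ℂ} (h : f =ᵐ[volume] 0) : cauchyMean f = 0 := by
  have h1 : f =ᵐ[cauchyMeasure] 0 := (withDensity_absolutelyContinuous _ _).ae_le h
  rw [cauchyMean, integral_congr_ae h1]
  simp

/-- This is where Lebesgue null sets enter: the primitive does not see them, whereas a spectral
measure of `H` might. -/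
theorem cauchyPrimitive_eq_zero {f : ℝ → ℂ} (h : f =ᵐ[volume] 0) :
    cauchyPrimitive f = fun _ => 0 := by
  ext t
  have h1 : f =ᵐ[cauchyMeasure.restrict (Set.Iic t)] 0 :=
    ae_restrict_of_ae ((withDensity_absolutelyContinuous _ _).ae_le h)
  rw [cauchyPrimitive, cauchyMean_eq_zero h]
  simp_rw [sub_zero]
  rw [integral_congr_ae h1]
  simp

end

/-! ### Commutation of `A` with functions of `H` and the vanishing of singular projections. -/

noncomputable section

set_option linter.unusedSectionVars false

open Filter Topology

namespace LinearPMap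

variable {E : Type*} [NormedAddCommGroup E] [InnerProductSpace ℂ E] [CompleteSpace E]
  {H A : E →ₗ.[ℂ] E}

theorem integral_cayleyFun (hH : IsSelfAdjoint H) (φ : E) :
    H.spectralMeasure.integral cayleyFun φ =
      φ + (2 * Complex.I) • H.resolventAt Complex.I φ := by
  have h := H.spectralMeasure.integral_add (BddMeas.const 1)
    (resolventFun_bddMeas.const_mul (2 * Complex.I))
  rw [H.spectralMeasure.integral_const_mul _ resolventFun_bddMeas, H.spectralMeasure.integral_one,
    spectralMeasure_integral_resolventFun hH] at h
  exact congrArg (fun L : E →L[ℂ] E => L φ) h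

theorem cayley_adjoint_apply (φ : E) :
    H.spectralMeasure.integral cayleyFun
      (ContinuousLinearMap.adjoint (H.spectralMeasure.integral cayleyFun) φ) = φ := by
  rw [← H.spectralMeasure.integral_conj cayleyFun_bddMeas,
    H.spectralMeasure.integral_apply_integral cayleyFun_bddMeas cayleyFun_bddMeas.conj]
  simp_rw [mul_comm (cayleyFun _), conj_cayleyFun_mul]
  rw [H.spectralMeasure.integral_one, one_apply_eq_self]

theorem commutator_spec (hH : IsSelfAdjoint H) (hA : IsSelfAdjoint A)
    (hC1 : A.IsClassC 1 (H.resolventAt Complex.I)) : ExtendsCommutator H A (H.commutator A) := by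
  have h := exists_extendsCommutator hH hA hC1
  have e : H.commutator A = h.choose := dif_pos h
  rw [e]
  exact h.choose_spec

/-- The sandwiched commutator in terms of the values of `A` on the range of the resolvent. -/
theorem inner_sandwichedCommutator_of_mem_graph (hH : IsSelfAdjoint H) (hA : IsSelfAdjoint A)
    (hC1 : A.IsClassC 1 (H.resolventAt Complex.I)) {φ ψ a b : E}
    (ha : (H.resolventAt Complex.I φ, a) ∈ A.graph)
    (hb : (H.resolventAt Complex.I ψ, b) ∈ A.graph) :
    inner ℂ φ (H.sandwichedCommutator A ψ) = Complex.I *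
      (inner ℂ (φ + Complex.I • H.resolventAt Complex.I φ) b -
        inner ℂ a (ψ + Complex.I • H.resolventAt Complex.I ψ)) := by
  have key : ∀ φ : E, ∃ u : H.domain, (u : E) = H.resolventAt Complex.I φ ∧
      H u = φ + Complex.I • H.resolventAt Complex.I φ ∧
      H.resolventToDom Complex.I φ = ⟨((u : E), H u), H.mem_graph u⟩ := by
    intro φ
    obtain ⟨u, h1, h2⟩ := (mem_graph_iff _).1 (resolventAt_mem_graph hH I_im_ne_zero φ)
    refine ⟨u, h1, h2, Subtype.ext (Prod.ext h1.symm ?_)⟩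
    exact (resolventToDom_snd hH I_im_ne_zero φ).trans h2.symm
  obtain ⟨u, hu1, hu2, hu3⟩ := key φ
  obtain ⟨v, hv1, hv2, hv3⟩ := key ψ
  obtain ⟨u', hu', hu''⟩ := (mem_graph_iff _).1 ha
  obtain ⟨v', hv', hv''⟩ := (mem_graph_iff _).1 hb
  have hu4 : (u : E) ∈ A.domain := by
    rw [hu1, ← show (u' : E) = H.resolventAt Complex.I φ from hu']
    exact u'.2
  have hv4 : (v : E) ∈ A.domain := by
    rw [hv1, ← show (v' : E) = H.resolventAt Complex.I ψ from hv']
    exact v'.2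
  have eu : A ⟨u, hu4⟩ = a := by
    rw [← show A u' = a from hu'']
    exact congrArg A (Subtype.ext (hu1.trans hu'.symm))
  have ev : A ⟨v, hv4⟩ = b := by
    rw [← show A v' = b from hv'']
    exact congrArg A (Subtype.ext (hv1.trans hv'.symm))
  rw [inner_sandwichedCommutator, hu3, hv3, commutator_spec hH hA hC1 u v hu4 hv4, eu, ev, hu2, hv2]

/-- The commutation relation `A V = V (A + 2 B)` on the domain of `A`, where `V` is the Cayley
transform of `H` and `B` is the sandwiched commutator. -/
theorem cayley_mem_graph (hH : IsSelfAdjoint H) (hA : IsSelfAdjoint A)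
    (hC1 : A.IsClassC 1 (H.resolventAt Complex.I)) {ψ b : E} (hψ : (ψ, b) ∈ A.graph) :
    (H.spectralMeasure.integral cayleyFun ψ, H.spectralMeasure.integral cayleyFun
      (b + (2 : ℂ) • H.sandwichedCommutator A ψ)) ∈ A.graph := by
  set V := H.spectralMeasure.integral cayleyFun with hV
  set R := H.resolventAt Complex.I with hR
  have hdom : ∀ {φ a : E}, (φ, a) ∈ A.graph → ∃ a', (R φ, a') ∈ A.graph := fun h =>
    (mem_domain_iff (f := A)).1 (hC1.apply_mem_domain hA (mem_domain_of_mem_graph h))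
  obtain ⟨b', hb'⟩ := hdom hψ
  have hVψ : V ψ = ψ + (2 * Complex.I) • R ψ := integral_cayleyFun hH ψ
  have hmem : (V ψ, b + (2 * Complex.I) • b') ∈ A.graph := by
    rw [hVψ]
    exact A.graph.add_mem hψ (A.graph.smul_mem (2 * Complex.I) hb')
  -- Since `V V* = 1`, it suffices to identify `V* A V ψ`, and this is tested against the dense
  -- domain of `A`, where the sandwiched commutator is explicit.
  have hy : ContinuousLinearMap.adjoint V (b + (2 * Complex.I) • b') =
      b + (2 : ℂ) • H.sandwichedCommutator A ψ := by
    refine hA.dense_domain.eq_of_inner_right ℂ fun φ hφ => ?_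
    obtain ⟨a, ha⟩ := (mem_domain_iff (f := A)).1 hφ
    obtain ⟨a', ha'⟩ := hdom ha
    have hVφ : V φ = φ + (2 * Complex.I) • R φ := integral_cayleyFun hH φ
    have e1 := inner_sandwichedCommutator_of_mem_graph hH hA hC1 ha' hb'
    have e2 : inner ℂ a' ψ = inner ℂ (R φ) b := inner_graph_of_isSelfAdjoint hA ha' hψ
    have e3 : inner ℂ a' (R ψ) = inner ℂ (R φ) b' := inner_graph_of_isSelfAdjoint hA ha' hb'
    have e0 : inner ℂ φ (b + (2 : ℂ) • H.sandwichedCommutator A ψ) =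
        inner ℂ φ b + 2 * inner ℂ φ (H.sandwichedCommutator A ψ) := by
      rw [inner_add_right, inner_smul_right]
    rw [ContinuousLinearMap.adjoint_inner_right, hVφ, e0, e1]
    simp only [inner_add_left, inner_add_right, inner_smul_left, inner_smul_right,
      _root_.map_mul, Complex.conj_I, Complex.conj_ofNat, ← hR, e2, e3]
    ring
  rw [← hy, cayley_adjoint_apply]
  exact hmem

end LinearPMap

section Commutation

variable {E : Type*} [NormedAddCommGroup E] [InnerProductSpace ℂ E] [CompleteSpace E]
  {H A : E →ₗ.[ℂ] E}

/-- The commutator form `⟪a, B φ⟫ - ⟪φ, B a⟫`, with `a = A φ`. -/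
def commForm (φ a : E) (B : E →L[ℂ] E) : ℂ := inner ℂ a (B φ) - inner ℂ φ (B a)

theorem commForm_add (φ a : E) (B D : E →L[ℂ] E) :
    commForm φ a (B + D) = commForm φ a B + commForm φ a D := by
  simp only [commForm, add_apply, inner_add_right]
  ring

theorem commForm_smul (φ a : E) (c : ℂ) (B : E →L[ℂ] E) :
    commForm φ a (c • B) = c * commForm φ a B := by
  simp only [commForm, smul_apply, inner_smul_right]
  ring

theorem commForm_adjoint (φ a : E) (B : E →L[ℂ] E) :
    commForm φ a (ContinuousLinearMap.adjoint B) = -starRingEnd ℂ (commForm φ a B) := by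
  simp only [commForm, ContinuousLinearMap.adjoint_inner_right, map_sub, inner_conj_symm]
  ring

variable {g : ℝ → ℝ}

/-- Here the hypothesis on the commutator is decisive: `g(H)` commutes with `V`, so each application
of `A V = V (A + 2 g(H))` contributes the same term `2 Vⁿ g(H)`. -/
theorem cayley_pow_mem_graph (hH : IsSelfAdjoint H) (hA : IsSelfAdjoint A)
    (hC1 : A.IsClassC 1 (H.resolventAt Complex.I)) (hg : BddMeas fun x => (g x : ℂ))
    (hcomm : H.sandwichedCommutator A = H.fc fun x => (g x : ℂ)) {ψ b : E} (hψ : (ψ, b) ∈ A.graph)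
    (n : ℕ) :
    (H.spectralMeasure.integral (fun x => cayleyFun x ^ n) ψ,
      H.spectralMeasure.integral (fun x => cayleyFun x ^ n) b +
        (2 * n : ℂ) • H.spectralMeasure.integral (fun x => cayleyFun x ^ n * g x) ψ) ∈ A.graph := by
  set P := H.spectralMeasure with hP
  have hc := cayleyFun_bddMeas
  induction n with
  | zero => simpa [P.integral_one] using hψ
  | succ n ih =>
    have h := LinearPMap.cayley_mem_graph hH hA hC1 ih
    have hcomm' : H.sandwichedCommutator A = P.integral fun x => (g x : ℂ) := hcomm
    rw [hcomm', ← hP, map_add, map_add, map_smul, map_smul, P.integral_apply_integral hc (hc.pow n),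
      P.integral_apply_integral hc (hc.pow n), P.integral_apply_integral hc ((hc.pow n).mul hg),
      P.integral_apply_integral hg (hc.pow n),
      P.integral_apply_integral hc (hg.mul (hc.pow n))] at h
    have e1 : (fun x => cayleyFun x * cayleyFun x ^ n) = fun x => cayleyFun x ^ (n + 1) := by
      ext x
      ring
    have e2 : (fun x => cayleyFun x * (cayleyFun x ^ n * g x)) =
        fun x => cayleyFun x ^ (n + 1) * g x := by
      ext x
      ring
    have e3 : (fun x => cayleyFun x * (g x * cayleyFun x ^ n)) =
        fun x => cayleyFun x ^ (n + 1) * g x := by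
      ext x
      ring
    rw [e1, e2, e3, add_assoc, ← add_smul] at h
    convert h using 4
    push_cast
    ring

theorem commForm_zpow (hH : IsSelfAdjoint H) (hA : IsSelfAdjoint A)
    (hC1 : A.IsClassC 1 (H.resolventAt Complex.I)) (hg : BddMeas fun x => (g x : ℂ))
    (hcomm : H.sandwichedCommutator A = H.fc fun x => (g x : ℂ)) {φ a : E} (hφ : (φ, a) ∈ A.graph)
    (n : ℤ) :
    commForm φ a (H.spectralMeasure.integral fun x => cayleyFun x ^ n) =
      2 * n * ∫ x, cayleyFun x ^ n * g x ∂(H.spectralMeasure.measure φ) := by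
  set P := H.spectralMeasure with hP
  have hc := cayleyFun_bddMeas
  have hnat : ∀ n : ℕ, commForm φ a (P.integral fun x => cayleyFun x ^ n) =
      2 * n * ∫ x, cayleyFun x ^ n * g x ∂(P.measure φ) := by
    intro n
    have h := LinearPMap.inner_graph_of_isSelfAdjoint hA hφ
      (cayley_pow_mem_graph hH hA hC1 hg hcomm hφ n)
    simp only [inner_add_right, inner_smul_right] at h
    rw [commForm, ← P.inner_integral ((hc.pow n).mul hg), h]
    ring
  obtain ⟨m, rfl | rfl⟩ := n.eq_nat_or_neg
  · simpa using hnat m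
  -- Negative powers are adjoints of positive ones. The sign in `commForm_adjoint` matches the sign
  -- of the exponent because `g` is real.
  · have e : ∀ x, cayleyFun x ^ (-(m : ℤ)) = starRingEnd ℂ (cayleyFun x ^ m) := by
      intro x
      rw [zpow_neg, zpow_natCast, ← inv_pow, cayleyFun_inv, map_pow]
    simp_rw [e]
    rw [P.integral_conj (hc.pow m), commForm_adjoint, hnat m]
    have e2 : ∫ x, starRingEnd ℂ (cayleyFun x ^ m) * g x ∂(P.measure φ) =
        starRingEnd ℂ (∫ x, cayleyFun x ^ m * g x ∂(P.measure φ)) := by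
      rw [← integral_conj]
      simp
    rw [e2]
    simp only [map_mul, Complex.conj_ofNat, map_natCast]
    push_cast
    ring

/-- The commutator of `A` with the primitive of `k` is the function `g (k - mean k)` of `H`. -/
theorem commForm_cauchyPrimitive (hH : IsSelfAdjoint H) (hA : IsSelfAdjoint A)
    (hC1 : A.IsClassC 1 (H.resolventAt Complex.I)) (hg : BddMeas fun x => (g x : ℂ))
    (hcomm : H.sandwichedCommutator A = H.fc fun x => (g x : ℂ)) {φ a : E} (hφ : (φ, a) ∈ A.graph)
    {k : ℝ → ℂ} (hk : BddMeas k) :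
    BddMeas (cauchyPrimitive k) ∧
      commForm φ a (H.spectralMeasure.integral (cauchyPrimitive k)) =
        Complex.I * ∫ x, (k x - cauchyMean k) * g x ∂(H.spectralMeasure.measure φ) := by
  set P := H.spectralMeasure with hP
  refine hk.induction_cayleyFun (p := fun k => BddMeas (cauchyPrimitive k) ∧
    commForm φ a (P.integral (cauchyPrimitive k)) =
      Complex.I * ∫ x, (k x - cauchyMean k) * g x ∂(P.measure φ)) ?_ ?_ ?_ ?_
  · intro n
    -- For `n = 0` subtracting the mean leaves nothing. For `n ≠ 0` the factor `i/(2n)` of the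
    -- primitive cancels the `2n` of `commForm_zpow`, so that the resulting formula is independent
    -- of `n`.
    rcases eq_or_ne n 0 with rfl | hn
    · simp only [zpow_zero, cauchyPrimitive_one, cauchyMean_one, sub_self, zero_mul, integral_zero,
        mul_zero]
      refine ⟨BddMeas.const 0, ?_⟩
      rw [P.integral_const, zero_smul]
      simp [commForm]
    · have hz := cayleyFun_zpow_bddMeas n
      have hn' : (n : ℂ) ≠ 0 := by exact_mod_cast hn
      rw [cauchyPrimitive_zpow hn, cauchyMean_zpow hn]
      refine ⟨(hz.sub (BddMeas.const 1)).const_mul _, ?_⟩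
      have e0 : inner ℂ a φ = inner ℂ φ a := LinearPMap.inner_graph_of_isSelfAdjoint hA hφ hφ
      have e1 : commForm φ a (-1) = 0 := by simp [commForm, e0]
      rw [P.integral_const_mul _ (hz.sub (BddMeas.const 1)), P.integral_sub hz (BddMeas.const 1),
        P.integral_one, sub_eq_add_neg, commForm_smul, commForm_add, e1,
        commForm_zpow hH hA hC1 hg hcomm hφ n]
      simp_rw [sub_zero]
      field_simp
      ring
  · rintro f f' hf hf' ⟨h1, h2⟩ ⟨h1', h2'⟩
    rw [cauchyPrimitive_add hf hf']
    refine ⟨h1.add h1', ?_⟩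
    rw [P.integral_add h1 h1', commForm_add, h2, h2', ← mul_add,
      ← integral_add (((hf.sub (BddMeas.const _)).mul hg).integrable _)
        (((hf'.sub (BddMeas.const _)).mul hg).integrable _), cauchyMean_add hf hf']
    congr 2
    ext x
    ring
  · rintro c f hf ⟨h1, h2⟩
    rw [cauchyPrimitive_const_mul]
    refine ⟨h1.const_mul c, ?_⟩
    rw [P.integral_const_mul c h1, commForm_smul, h2, cauchyMean_const_mul, mul_left_comm,
      ← integral_const_mul]
    congr 2
    ext x
    ring
  · intro F f C hF hC hlim h
    have hle : ∀ n t, ‖cauchyPrimitive (F n) t‖ ≤ 2 * C * Real.pi := fun n =>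
      norm_cauchyPrimitive_le (hC n)
    have hpl := tendsto_cauchyPrimitive hF hC hlim
    refine ⟨BddMeas.of_tendsto (fun n => (h n).1) hle hpl, ?_⟩
    have l1 : Tendsto (fun n => commForm φ a (P.integral (cauchyPrimitive (F n)))) atTop
        (𝓝 (commForm φ a (P.integral (cauchyPrimitive f)))) :=
      (P.tendsto_inner_integral (fun n => (h n).1) hle hpl a φ).sub
        (P.tendsto_inner_integral (fun n => (h n).1) hle hpl φ a)
    refine tendsto_nhds_unique l1 ?_
    simp_rw [fun n => (h n).2]
    obtain ⟨G, hG⟩ := hg.bounded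
    refine Tendsto.const_mul _ (tendsto_integral_of_dominated_convergence (fun _ => 2 * C * G)
      (fun n => (((hF n).sub (BddMeas.const _)).mul hg).measurable.aestronglyMeasurable)
      (integrable_const _) (fun n => ae_of_all _ fun x => ?_) (ae_of_all _ fun x =>
        ((hlim x).sub (tendsto_cauchyMean hF hC hlim)).mul_const _))
    have h0 : 0 ≤ C := (norm_nonneg _).trans (hC 0 0)
    rw [norm_mul]
    refine mul_le_mul ?_ (hG x) (norm_nonneg _) (by positivity)
    have := norm_sub_le (F n x) (cauchyMean (F n))
    linarith [hC n x, norm_cauchyMean_le (hC n)]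

/-- The spectral projection of `H` on the part of a Lebesgue null set where `g` does not vanish is
zero. -/
theorem proj_inter_eq_zero (hH : IsSelfAdjoint H) (hA : IsSelfAdjoint A)
    (hC1 : A.IsClassC 1 (H.resolventAt Complex.I)) (hg : BddMeas fun x => (g x : ℂ))
    (hgm : Measurable g)
    (hcomm : H.sandwichedCommutator A = H.fc fun x => (g x : ℂ)) {s : Set ℝ}
    (hs : MeasurableSet s) (hs0 : volume s = 0) :
    H.spectralMeasure.proj (s ∩ (g ⁻¹' {0})ᶜ) = 0 := by
  have hΛ : MeasurableSet (g ⁻¹' {0})ᶜ := (hgm (measurableSet_singleton 0)).compl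
  have key : ∀ φ ∈ A.domain, H.spectralMeasure.proj (s ∩ (g ⁻¹' {0})ᶜ) φ = 0 := by
    intro φ hφ
    obtain ⟨a, ha⟩ := (LinearPMap.mem_domain_iff (f := A)).1 hφ
    set μ := H.spectralMeasure.measure φ with hμ
    -- The sign of `g` on `s`, with value `0` where `g` vanishes by the convention on division; it
    -- turns the integral of `k g` into that of `|g|` over `s`.
    let k : ℝ → ℂ := s.indicator fun x => ((g x / |g x| : ℝ) : ℂ)
    have hsign : ∀ x, ((g x / |g x| : ℝ) : ℂ) * g x = (|g x| : ℝ) := by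
      intro x
      rw [← Complex.ofReal_mul, div_mul_eq_mul_div, ← abs_mul_abs_self, mul_self_div_self]
    have hk : BddMeas k := by
      refine BddMeas.indicator ⟨Complex.measurable_ofReal.comp (hgm.div hgm.abs), 1, fun x => ?_⟩ hs
      change ‖((g x / |g x| : ℝ) : ℂ)‖ ≤ 1
      rw [Complex.norm_real, norm_div, Real.norm_eq_abs, Real.norm_eq_abs, abs_abs]
      exact div_self_le_one _
    have hk0 : k =ᵐ[volume] 0 := by
      have : ∀ᵐ x ∂(volume : Measure ℝ), x ∉ s := measure_eq_zero_iff_ae_notMem.1 hs0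
      filter_upwards [this] with x hx
      exact Set.indicator_of_notMem hx _
    have h := (commForm_cauchyPrimitive hH hA hC1 hg hcomm ha hk).2
    rw [cauchyPrimitive_eq_zero hk0, cauchyMean_eq_zero hk0, H.spectralMeasure.integral_const,
      zero_smul] at h
    have h0 : ∫ x, s.indicator (fun x => |g x|) x ∂μ = 0 := by
      have e : (fun x => (k x - 0) * g x) = fun x => ((s.indicator (fun x => |g x|) x : ℝ) : ℂ) := by
        ext x
        by_cases hx : x ∈ s
        · simp only [k, Set.indicator_of_mem hx, sub_zero, hsign]
        · simp [k, hx]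
      rw [e, integral_complex_ofReal] at h
      simp only [commForm, zero_apply, inner_zero_right, sub_zero] at h
      have := (mul_eq_zero.1 h.symm).resolve_left Complex.I_ne_zero
      exact_mod_cast this
    have hi : Integrable (s.indicator fun x => |g x|) μ := by
      have := ((hg.integrable μ).norm).indicator hs
      simpa using this
    have h1 := (integral_eq_zero_iff_of_nonneg
      (fun x => Set.indicator_nonneg (fun _ _ => abs_nonneg _) x) hi).1 h0
    rw [← H.spectralMeasure.measure_eq_zero_iff _ (hs.inter hΛ)]
    refine measure_mono_null (fun x hx => ?_) h1
    change ¬ s.indicator (fun x => |g x|) x = 0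
    rw [Set.indicator_of_mem hx.1, abs_eq_zero]
    exact hx.2
  ext φ
  exact congrFun (Continuous.ext_on hA.dense_domain
    (H.spectralMeasure.proj (s ∩ (g ⁻¹' {0})ᶜ)).continuous (continuous_const (y := (0 : E))) key) φ

/-- A Lebesgue essential bound says nothing about a singular spectral measure. Continuity makes it
pointwise: the set where it holds is closed and of full measure, hence dense. -/
theorem norm_le_of_memLp_top (hg : Continuous g) (h : MemLp g ⊤ (volume : Measure ℝ)) :
    ∃ M : ℝ, ∀ x, ‖g x‖ ≤ M := by
  refine ⟨(eLpNorm g ⊤ volume).toReal, fun x => ?_⟩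
  have hae : ∀ᵐ x ∂(volume : Measure ℝ), ‖g x‖ ≤ (eLpNorm g ⊤ volume).toReal := by
    filter_upwards [ae_le_eLpNormEssSup (f := g) (μ := (volume : Measure ℝ))] with x hx
    rw [← eLpNorm_exponent_top] at hx
    rw [← toReal_enorm]
    exact ENNReal.toReal_mono h.2.ne hx
  have hcl : IsClosed {x | ‖g x‖ ≤ (eLpNorm g ⊤ volume).toReal} :=
    isClosed_le hg.norm continuous_const
  have hd : Dense {x | ‖g x‖ ≤ (eLpNorm g ⊤ volume).toReal} := Measure.dense_of_ae hae
  have : x ∈ closure {x | ‖g x‖ ≤ (eLpNorm g ⊤ volume).toReal} := hd x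
  rwa [hcl.closure_eq] at this

end Commutation

end

theorem corollary4p4 {E : Type*} [NormedAddCommGroup E] [InnerProductSpace ℂ E] [CompleteSpace E]
    (H A : E →ₗ.[ℂ] E) (hH : IsSelfAdjoint H) (hA : IsSelfAdjoint A)
    (hC1 : A.IsClassC 1 (H.resolventAt Complex.I))
    (g : ℝ → ℝ) (hg : ContDiff ℝ 2 g) (hg_bdd : MemLp g ⊤ (volume : Measure ℝ))
    (hcomm : H.sandwichedCommutator A = H.fc fun x => (g x : ℂ)) :
    (H.restrictTo (H.spectralMeasure.range (g ⁻¹' {0})ᶜ)).HasPurelyACSpectrum := by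
  have hgm : Measurable g := hg.continuous.measurable
  have hΛ : MeasurableSet (g ⁻¹' {0})ᶜ := (hgm (measurableSet_singleton 0)).compl
  obtain ⟨M, hM⟩ := norm_le_of_memLp_top hg.continuous hg_bdd
  have hgb : BddMeas fun x => (g x : ℂ) :=
    ⟨Complex.measurable_ofReal.comp hgm, M, fun x => by rw [Complex.norm_real]; exact hM x⟩
  obtain ⟨hsa, hmeas⟩ := LinearPMap.isSelfAdjoint_restrictTo_range hH hΛ
  refine ⟨hsa, fun u => Measure.AbsolutelyContinuous.mk fun s hs hs0 => ?_⟩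
  -- On the spectral subspace of `Λ` the projection of `s` acts as that of `s ∩ Λ`, which vanishes.
  rw [hmeas, PVM.measure_eq_zero_iff _ _ hs, ← (PVM.mem_range_iff _).1 u.2]
  have h := H.spectralMeasure.proj_inter s _ hs hΛ
  rw [proj_inter_eq_zero hH hA hC1 hgb hgm hcomm hs hs0] at h
  exact congrArg (fun L : E →L[ℂ] E => L u) h.symm
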